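/- All hypergraphs are finite and have no repeated hyperedges. A hypergraph is \(k\)-uniform if each hyperedge has exactly \(k\) vertices; a hypertree is a connected hypergraph without (Berge) cycles, where cycles of length \(2\), i.e. two hyperedges sharing two vertices, count as cycles. The hyperpath \(P_m^{(k)}\) has the vertices \(0,1,\dots,m(k-1)\) and the \(m\) hyperedges \(\{i(k-1),\,i(k-1)+1,\dots,(i+1)(k-1)\}\), \(0\le i<m\). For a \(k\)-uniform hypergraph \(\mathcal H\) on \(n\) vertices let \(\mathcal A(\mathcal H)\) be its adjacency tensor, of order \(k\) and dimension \(n\), with entry \(a_{i_1\cdots i_k}=\frac1{(k-1)!}\) if \(\{i_1,\dots,i_k\}\in E(\mathcal H)\) and \(0\) otherwise; let \(\mathcal D(\mathcal H)\) be the diagonal tensor of the vertex degrees, and \(\mathcal A_\alpha(\mathcal H)=\alpha\mathcal D(\mathcal H)+(1-\alpha)\mathcal A(\mathcal H)\). The \(d\)-th order trace of a tensor \(\mathcal T\) of order \(k\) and dimension \(n\) is \[ \mathrm{Tr}_d(\mathcal T)=(k-1)^{n-1}\sum_{d_1+\cdots+d_n=d}\ \prod_{i=1}^n\frac1{(d_i(k-1))!}\Bigl(\sum_{x\in[n]^{k-1}}\mathcal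 T_{ix}\frac{\partial}{\partial a_{ix}}\Bigr)^{d_i}\mathrm{tr}\bigl(A^{d(k-1)}\bigr), \] where \(A=(a_{ij})\) is an \(n\times n\) matrix of indeterminates, the \(d_i\) are nonnegative integers, and \(\frac{\partial}{\partial a_{ix}}=\frac{\partial}{\partial a_{ii_2}}\cdots\frac{\partial}{\partial a_{ii_k}}\) for \(x=i_2\cdots i_k\). For \(k\)-uniform hypergraphs \(\mathcal H_1,\mathcal H_2\) with the same number \(n\) of vertices, write \(\mathcal H_1\prec_\alpha\mathcal H_2\) (\(\mathcal H_1\) comes before \(\mathcal H_2\) in \(S_\alpha\)-order) if there is an integer \(d\) with \(1\le d\le n(k-1)^{n-1}-1\) such that \(\mathrm{Tr}_t(\mathcal A_\alpha(\mathcal H_1))=\mathrm{Tr}_t(\mathcal A_\alpha(\mathcal H_2))\) for \(t=0,1,\dots,d-1\) and \(\mathrm{Tr}_d(\mathcal A_\alpha(\mathcal H_1))<\mathrm{Tr}_d(\mathcal A_\alpha(\mathcal H_2))\). Write \(\mathcal H_1=_\alpha\mathcal H_2\) if the traces of all orders \(t=0,1,\dots,n(k-1)^{n-1}-1\) agree,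 and \(\mathcal H_1\preceq_\alpha\mathcal H_2\) if \(\mathcal H_1\prec_\alpha\mathcal H_2\) or \(\mathcal H_1=_\alpha\mathcal H_2\). **Theorem.** Let \(k\ge3\), \(m\ge0\) and \(0<\alpha<1\). Among all \(k\)-uniform hypertrees with \(m\) hyperedges, the hyperpath \(P_m^{(k)}\) is the first in \(S_\alpha\)-order. That is, \(P_m^{(k)}\) is a \(k\)-uniform hypertree with \(m\) hyperedges, and every \(k\)-uniform hypertree \(T\) with \(m\) hyperedges has the same number of vertices as \(P_m^{(k)}\) and satisfies \(P_m^{(k)}\preceq_\alpha T\), and \(P_m^{(k)}\prec_\alpha T\) whenever \(T\) is not isomorphic to \(P_m^{(k)}\). -/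

import Mathlib

/-! ### Tensors and their traces -/

/-- A tensor of order `k` (`k ≥ 1`) whose indices range over `ι`. The entry with index
`i i₂ ⋯ i_k` is `𝓐 i x`, where `x = (i₂, …, i_k)` has `k - 1` components. -/
abbrev HTensor (k : ℕ) (ι R : Type*) : Type _ := ι → (Fin (k - 1) → ι) → R

namespace HTensor

variable {k : ℕ} {ι R : Type*} [Field R]

/-- The constant-coefficient operator `∂/∂a_{ix} = ∂/∂a_{i i₂} ⋯ ∂/∂a_{i i_k}`, for
`x = (i₂, …, i_k)`, on the polynomials in the entries `a_{ij}` of the auxiliary matrix. -/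
noncomputable def partialOp (i : ι) (x : Fin (k - 1) → ι) :
    Module.End R (MvPolynomial (ι × ι) R) :=
  (List.ofFn fun j => (MvPolynomial.pderiv (R := R) (i, x j)).toLinearMap).prod

/-- The operator `∑_x 𝓐_{ix} ∂/∂a_{ix}`, where `x` runs over all `(k-1)`-tuples of indices. -/
noncomputable def rowOp [Fintype ι] (A : HTensor k ι R) (i : ι) :
    Module.End R (MvPolynomial (ι × ι) R) :=
  open Classical in ∑ x : Fin (k - 1) → ι, A i x • partialOp i x

theorem pderiv_commute (a b : ι × ι) :
    Commute (MvPolynomial.pderiv (R := R) a).toLinearMap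
      ((MvPolynomial.pderiv (R := R) b).toLinearMap :
        Module.End R (MvPolynomial (ι × ι) R)) := by
  have h : ⁅MvPolynomial.pderiv (R := R) a, MvPolynomial.pderiv (R := R) b⁆ = 0 := by
    classical
    apply MvPolynomial.derivation_ext
    intro i
    simp [Derivation.commutator_apply, MvPolynomial.pderiv_X, Pi.single_apply, apply_ite]
  refine LinearMap.ext fun p => ?_
  have := DFunLike.congr_fun h p
  rw [Derivation.commutator_apply] at this
  exact sub_eq_zero.mp this

theorem rowOp_commute [Fintype ι] (A : HTensor k ι R) (i j : ι) :
    Commute (rowOp A i) (rowOp A j) := by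
  unfold rowOp partialOp
  refine Commute.sum_left _ _ _ fun x _ => Commute.sum_right _ _ _ fun y _ => ?_
  refine Commute.smul_left (Commute.smul_right ?_ _) _
  refine Commute.list_prod_left _ _ fun f hf => Commute.list_prod_right _ _ fun g hg => ?_
  obtain ⟨a, rfl⟩ := List.mem_ofFn.mp hf
  obtain ⟨b, rfl⟩ := List.mem_ofFn.mp hg
  exact pderiv_commute _ _

theorem rowOp_pairwise [Fintype ι] (A : HTensor k ι R) (δ : ι → ℕ) :
    ((Finset.univ : Finset ι) : Set ι).Pairwise (Function.onFun Commute
      fun i => ((Nat.factorial (δ i * (k - 1)) : R)⁻¹) • rowOp A i ^ δ i) :=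
  fun i _ j _ _ => (((rowOp_commute A i j).pow_pow _ _).smul_left _).smul_right _

/-- The `d`-th order trace of a tensor of order `k` and dimension `n = |ι|`,
`Tr_d(𝓐) = (k-1)^{n-1} ∑_{d₁+⋯+d_n=d} ∏_i 1/(d_i(k-1))! (∑_x 𝓐_{ix} ∂/∂a_{ix})^{d_i} tr(A^{d(k-1)})`,
where `A = (a_{ij})` is the auxiliary matrix of `n²` variables. The operator has the same order
as the degree of the homogeneous polynomial `tr(A^{d(k-1)})`, so that the result is a constant
polynomial; `constantCoeff` reads it as a scalar. -/
noncomputable def trace [Fintype ι] (d : ℕ) (A : HTensor k ι R) : R :=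
  open Classical in
  ((k : R) - 1) ^ (Fintype.card ι - 1) *
    ∑ δ ∈ Finset.piAntidiag (Finset.univ : Finset ι) d,
      MvPolynomial.constantCoeff
        ((Finset.univ.noncommProd
            (fun i => ((Nat.factorial (δ i * (k - 1)) : R)⁻¹) • rowOp A i ^ δ i)
            (rowOp_pairwise A δ))
          (Matrix.trace (Matrix.mvPolynomialX ι ι R ^ (d * (k - 1)))))

end HTensor

/-! ### Hypergraphs -/

namespace Hypergraph

/-- Every hyperedge has exactly `k` vertices. -/
def IsUniform {V : Type*} (H : Hypergraph V) (k : ℕ) : Prop :=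
  ∀ e ∈ H.edgeSet, e.ncard = k

/-- The number of hyperedges that contain `v`. -/
noncomputable def degree {V : Type*} (H : Hypergraph V) (v : V) : ℕ :=
  {e ∈ H.edgeSet | v ∈ e}.ncard

/-- There is a vertex, and any two vertices are joined by a walk. -/
def IsConnected {V : Type*} (H : Hypergraph V) : Prop :=
  H.vertexSet.Nonempty ∧
    ∀ u ∈ H.vertexSet, ∀ v ∈ H.vertexSet, Relation.ReflTransGen H.Adj u v

/-- A (Berge) cycle `v₀ e₀ v₁ e₁ ⋯ v_{l+1} e_{l+1} v₀` of length `l + 2 ≥ 2`: distinct vertices,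
distinct hyperedges, and `v_i, v_{i+1} ∈ e_i` with indices modulo the length. -/
def IsCycle {V : Type*} (H : Hypergraph V) {l : ℕ}
    (v : Fin (l + 2) → V) (e : Fin (l + 2) → Set V) : Prop :=
  Function.Injective v ∧ Function.Injective e ∧
    ∀ i, e i ∈ H.edgeSet ∧ v i ∈ e i ∧ v (i + 1) ∈ e i

/-- A hypertree is a connected hypergraph without cycles. -/
def IsHypertree {V : Type*} (H : Hypergraph V) : Prop :=
  H.IsConnected ∧
    ∀ (l : ℕ) (v : Fin (l + 2) → V) (e : Fin (l + 2) → Set V), ¬ H.IsCycle v e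

/-- Two hypergraphs are isomorphic: a bijection of the vertex sets matches the hyperedges. -/
def IsIsomorphic {V W : Type*} (H : Hypergraph V) (G : Hypergraph W) : Prop :=
  ∃ σ : H.vertexSet ≃ G.vertexSet, ∀ s : Set H.vertexSet,
    Subtype.val '' s ∈ H.edgeSet ↔ Subtype.val '' (σ '' s) ∈ G.edgeSet

/-- The `k`-uniform hyperpath with `m` hyperedges: its vertices are `0, 1, …, m(k-1)`, and its
hyperedges are the blocks `{i(k-1), i(k-1)+1, …, (i+1)(k-1)}` for `0 ≤ i < m`, so that consecutive
hyperedges share exactly one vertex. -/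
def hyperpath (k m : ℕ) : Hypergraph ℕ where
  vertexSet := Set.Iic (m * (k - 1))
  edgeSet := {e | ∃ i < m, e = Set.Icc (i * (k - 1)) ((i + 1) * (k - 1))}
  subset_vertexSet_of_mem_edgeSet' := by
    rintro e ⟨i, hi, rfl⟩ x hx
    exact hx.2.trans (Nat.mul_le_mul_right _ hi)

instance (k m : ℕ) : Fintype (hyperpath k m).vertexSet :=
  inferInstanceAs (Fintype (Set.Iic (m * (k - 1))))

/-- The adjacency tensor of a `k`-uniform hypergraph: the entry with index `i₁ i₂ ⋯ i_k` is
`1/(k-1)!` if `{i₁, …, i_k}` is a hyperedge, and `0` otherwise. -/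
noncomputable def adjTensor {V : Type*} (H : Hypergraph V) (k : ℕ) : HTensor k H.vertexSet ℝ :=
  open Classical in
  fun i x =>
    if insert (i : V) (Set.range fun j => (x j : V)) ∈ H.edgeSet
    then 1 / (Nat.factorial (k - 1) : ℝ) else 0

/-- The degree tensor: the diagonal tensor of order `k` of the vertex degrees. -/
noncomputable def degTensor {V : Type*} (H : Hypergraph V) (k : ℕ) : HTensor k H.vertexSet ℝ :=
  open Classical in
  fun i x => if ∀ j, x j = i then (H.degree (i : V) : ℝ) else 0

/-- The `𝓐_α`-tensor `α 𝓓(H) + (1 - α) 𝓐(H)`. -/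
noncomputable def alphaTensor {V : Type*} (H : Hypergraph V) (k : ℕ) (α : ℝ) :
    HTensor k H.vertexSet ℝ :=
  α • H.degTensor k + (1 - α) • H.adjTensor k

/-- The `d`-th order trace of the `𝓐_α`-tensor, that is, the `d`-th `𝓐_α`-spectral moment. -/
noncomputable def alphaTrace {V : Type*} (H : Hypergraph V) [Fintype H.vertexSet]
    (k : ℕ) (α : ℝ) (d : ℕ) : ℝ :=
  HTensor.trace d (H.alphaTensor k α)

/-- `H` comes before `G` in `S_α`-order, `H ≺_α G`: both have the same number `n` of vertices, and
for some `d` with `1 ≤ d ≤ n(k-1)^{n-1} - 1` the traces of all orders below `d` agree and the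
one of order `d` is smaller for `H`. -/
def AlphaLT {V W : Type*} (k : ℕ) (α : ℝ) (H : Hypergraph V) (G : Hypergraph W)
    [Fintype H.vertexSet] [Fintype G.vertexSet] : Prop :=
  Fintype.card H.vertexSet = Fintype.card G.vertexSet ∧
    ∃ d : ℕ, 1 ≤ d ∧
      d ≤ Fintype.card H.vertexSet * (k - 1) ^ (Fintype.card H.vertexSet - 1) - 1 ∧
      (∀ t < d, H.alphaTrace k α t = G.alphaTrace k α t) ∧
      H.alphaTrace k α d < G.alphaTrace k α d

/-- `H =_α G`: both have the same number `n` of vertices, and the traces of the orders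
`0, 1, …, n(k-1)^{n-1} - 1` agree. -/
def AlphaEq {V W : Type*} (k : ℕ) (α : ℝ) (H : Hypergraph V) (G : Hypergraph W)
    [Fintype H.vertexSet] [Fintype G.vertexSet] : Prop :=
  Fintype.card H.vertexSet = Fintype.card G.vertexSet ∧
    ∀ t ≤ Fintype.card H.vertexSet * (k - 1) ^ (Fintype.card H.vertexSet - 1) - 1,
      H.alphaTrace k α t = G.alphaTrace k α t

/-- `H ≼_α G`: `H ≺_α G` or `H =_α G`. -/
def AlphaLE {V W : Type*} (k : ℕ) (α : ℝ) (H : Hypergraph V) (G : Hypergraph W)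
    [Fintype H.vertexSet] [Fintype G.vertexSet] : Prop :=
  AlphaLT k α H G ∨ AlphaEq k α H G

end Hypergraph

/-! The traces of order at most k + 2 already separate the hyperpath from every other hypertree, and
they can be computed because k + 2 < 2k for k ≥ 3.

The pairing ⟨p, f⟩ = ∑ M! p_M f_M makes differentiation adjoint to multiplication. Thus Tr_d becomes
a sum of pairings of tr(A^{d(k-1)}) with products of powers of row polynomials (`trace_eq_apolar`).
A coefficient of tr(A^N) counts closed walks with a given arc multiset, so it vanishes unless the
arcs are balanced at every vertex and lie in one component. A summand of row i is either k - 1 loops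
at i, with weight α deg(i), or the arcs from i to the rest of an edge containing i, with weight 1 -
α. In a hypertree every incidence of a vertex and an edge is a cut, so balance forces the k vertices
of an edge to use it equally often (`choice_weight_eq`). For d < 2k, at most one edge can therefore
occur, and then once for each of its vertices (`choice_classification`). This gives
`trace_edgeTensor`: the power sum ∑ (α d_v)^d of the degrees plus one term for each edge, which
involves only the degrees on that edge.

Let d_v be the degrees and s_e the sum of d_v over v ∈ e. All competitors share n = m(k-1) + 1 and ∑
d_v = km, so the traces of orders 0 and 1 agree. Order 2 compares ∑ d_v². As (d-1)(d-2) ≥ 0 at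
integers, this is minimal exactly when all degrees are 1 or 2, as in the hyperpath. If T also has
such degrees, all power sums of the degrees agree, and so do the traces through order k + 1. In
order k + 2 the only new quantity is ∑ s_e², with a positive coefficient. As ∑ s_e = ∑ d_v² is fixed
and (s-k-1)(s-k-2) ≥ 0 at integers, it is minimal when every s_e is k + 1 or k + 2, as in the
hyperpath with m ≥ 2.

It remains that d_v ≤ 2 and s_e ≤ k + 2 throughout force a hyperpath (`isIsomorphic_hyperpath`).
Counting yields an end edge (`exists_leaf`), and from there the edges line up in a chain without
branching (`exists_chain`). -/

/-! ### The apolar pairing and symbols of differential operators -/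

namespace MvPolynomial

variable {σ τ R : Type*} [CommSemiring R]

/-- The apolar pairing `⟨p, f⟩ = ∑_M M! · p_M · f_M` of polynomials, as a linear form in `p`. -/
noncomputable def apolar (f : MvPolynomial σ R) : MvPolynomial σ R →ₗ[R] R :=
  (basisMonomials σ R).constr R fun M => (M.prod fun _ n => (n.factorial : R)) * coeff M f

theorem apolar_monomial (f : MvPolynomial σ R) (M : σ →₀ ℕ) (c : R) :
    apolar f (monomial M c) = c * ((M.prod fun _ n => (n.factorial : R)) * coeff M f) := by
  have : (monomial M c : MvPolynomial σ R) = c • basisMonomials σ R M := by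
    simp [smul_monomial]
  rw [this, map_smul, apolar, Module.Basis.constr_basis, smul_eq_mul]

theorem apolar_one (f : MvPolynomial σ R) : apolar f 1 = constantCoeff f := by
  have : (1 : MvPolynomial σ R) = monomial 0 1 := rfl
  rw [this, apolar_monomial]
  simp [constantCoeff_eq]

theorem prod_factorial_add_single (M : σ →₀ ℕ) (s : σ) :
    ((M + Finsupp.single s 1).prod fun _ n => (n.factorial : R))
      = (M s + 1) * M.prod fun _ n => (n.factorial : R) := by
  classical
  set S := insert s M.support with hS
  have h1 : (M + Finsupp.single s 1).support ⊆ S := by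
    intro x hx
    rw [hS, Finset.mem_insert]
    by_contra! h
    rw [Finsupp.mem_support_iff] at hx
    simp [Finsupp.notMem_support_iff.1 h.2, h.1.symm] at hx
  rw [Finsupp.prod_of_support_subset _ h1 _ (by simp),
    Finsupp.prod_of_support_subset M (Finset.subset_insert _ _) _ (by simp),
    ← Finset.mul_prod_erase S _ (Finset.mem_insert_self _ _),
    ← Finset.mul_prod_erase S _ (Finset.mem_insert_self _ _), ← mul_assoc]
  congr 1
  · simp [Nat.factorial_succ]
  · refine Finset.prod_congr rfl fun x hx => ?_
    have : s ≠ x := (Finset.ne_of_mem_erase hx).symm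
    simp [this]

/-- Multiplication by a variable is adjoint to the partial derivative. -/
theorem apolar_X_mul (s : σ) (p f : MvPolynomial σ R) :
    apolar f (X s * p) = apolar (pderiv s f) p := by
  induction p using MvPolynomial.induction_on' with
  | add p q hp hq => rw [mul_add, map_add, map_add, hp, hq]
  | monomial M a =>
    rw [X, monomial_mul, one_mul, apolar_monomial, apolar_monomial, coeff_pderiv, add_comm,
      prod_factorial_add_single]
    ring

theorem apolar_rename {e : σ → τ} (he : Function.Injective e) (f p : MvPolynomial σ R) :
    apolar (rename e f) (rename e p) = apolar f p := by
  induction p using MvPolynomial.induction_on' with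
  | add p q hp hq => rw [map_add, map_add, map_add, hp, hq]
  | monomial M a =>
    rw [rename_monomial, apolar_monomial, apolar_monomial, coeff_rename_mapDomain e he,
      Finsupp.prod_mapDomain_index_inj he]

/-- `P` is the symbol of the differential operator `D`. -/
def IsSymbol (D : Module.End R (MvPolynomial σ R)) (P : MvPolynomial σ R) : Prop :=
  ∀ f p, apolar f (P * p) = apolar (D f) p

namespace IsSymbol

variable {D D' : Module.End R (MvPolynomial σ R)} {P P' : MvPolynomial σ R}

theorem pderiv (s : σ) :
    IsSymbol ((MvPolynomial.pderiv (R := R) s).toLinearMap : Module.End R (MvPolynomial σ R))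
      (X s) :=
  fun f p => apolar_X_mul s p f

theorem one : IsSymbol (1 : Module.End R (MvPolynomial σ R)) 1 := fun f p => by simp

theorem mul (h : IsSymbol D P) (h' : IsSymbol D' P') : IsSymbol (D * D') (P * P') :=
  fun f p => by rw [mul_comm P, mul_assoc, h', h]; rfl

theorem apolar_add_left (f g p : MvPolynomial σ R) :
    apolar (f + g) p = apolar f p + apolar g p := by
  induction p using MvPolynomial.induction_on' with
  | add p q hp hq => rw [map_add, map_add, map_add, hp, hq]; ring
  | monomial M a => simp only [apolar_monomial, coeff_add]; ring

theorem apolar_smul_left (c : R) (f p : MvPolynomial σ R) :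
    apolar (c • f) p = c * apolar f p := by
  induction p using MvPolynomial.induction_on' with
  | add p q hp hq => rw [map_add, map_add, hp, hq]; ring
  | monomial M a => simp only [apolar_monomial, coeff_smul, smul_eq_mul]; ring

theorem smul (c : R) (h : IsSymbol D P) : IsSymbol (c • D) (c • P) := fun f p => by
  rw [smul_mul_assoc, map_smul, h, LinearMap.smul_apply, apolar_smul_left, smul_eq_mul]

theorem add (h : IsSymbol D P) (h' : IsSymbol D' P') : IsSymbol (D + D') (P + P') := fun f p => by
  rw [add_mul, map_add, h, h', LinearMap.add_apply, apolar_add_left]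

theorem zero : IsSymbol (0 : Module.End R (MvPolynomial σ R)) 0 := fun f p => by
  have := apolar_smul_left 0 f p
  rw [zero_smul, zero_mul] at this
  rw [zero_mul, map_zero, LinearMap.zero_apply, this]

theorem sum {J : Type*} (s : Finset J) {D : J → Module.End R (MvPolynomial σ R)}
    {P : J → MvPolynomial σ R} (h : ∀ j ∈ s, IsSymbol (D j) (P j)) :
    IsSymbol (∑ j ∈ s, D j) (∑ j ∈ s, P j) := by
  classical
  induction s using Finset.induction_on with
  | empty => simpa using zero
  | insert a s ha ih =>
    rw [Finset.sum_insert ha, Finset.sum_insert ha]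
    exact (h a (by simp)).add (ih fun j hj => h j (by simp [hj]))

theorem pow (h : IsSymbol D P) (n : ℕ) : IsSymbol (D ^ n) (P ^ n) := by
  induction n with
  | zero => simpa using one
  | succ n ih => rw [pow_succ, pow_succ]; exact ih.mul h

theorem ofFn_prod {n : ℕ} {D : Fin n → Module.End R (MvPolynomial σ R)}
    {P : Fin n → MvPolynomial σ R} (h : ∀ j, IsSymbol (D j) (P j)) :
    IsSymbol (List.ofFn D).prod (∏ j, P j) := by
  induction n with
  | zero => simpa using one
  | succ n ih =>
    rw [List.ofFn_succ, List.prod_cons, Fin.prod_univ_succ]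
    exact (h 0).mul (ih fun j => h j.succ)

theorem noncommProd {J : Type*} (s : Finset J) {D : J → Module.End R (MvPolynomial σ R)}
    {P : J → MvPolynomial σ R} (comm) (h : ∀ j ∈ s, IsSymbol (D j) (P j)) :
    IsSymbol (s.noncommProd D comm) (∏ j ∈ s, P j) := by
  classical
  induction s using Finset.induction_on with
  | empty => simpa using one
  | insert a s ha ih =>
    rw [Finset.noncommProd_insert_of_notMem _ _ _ _ ha, Finset.prod_insert ha]
    exact (h a (by simp)).mul (ih _ fun j hj => h j (by simp [hj]))

/-- Pairing with the polynomial 1 reads off the constant coefficient; by adjointness D moves across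
and becomes its symbol. -/
theorem constantCoeff (h : IsSymbol D P) (f : MvPolynomial σ R) :
    constantCoeff (D f) = apolar f P := by
  rw [← apolar_one, ← h, mul_one]

end IsSymbol

end MvPolynomial

/-! ### The trace as an apolar pairing, and its invariance under relabelling -/

namespace HTensor

open MvPolynomial

variable {k : ℕ} {ι κ R : Type*} [Field R] [Fintype ι] [Fintype κ]

/-- The polynomial `∑_x 𝓐_{ix} a_{i i₂} ⋯ a_{i i_k}`, the symbol of `rowOp`. -/
noncomputable def rowPoly (A : HTensor k ι R) (i : ι) : MvPolynomial (ι × ι) R :=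
  open Classical in ∑ x : Fin (k - 1) → ι, A i x • ∏ j, X (i, x j)

theorem isSymbol_rowOp (A : HTensor k ι R) (i : ι) : IsSymbol (rowOp A i) (rowPoly A i) :=
  IsSymbol.sum _ fun _ _ => (IsSymbol.ofFn_prod fun _ => IsSymbol.pderiv _).smul _

/-- The trace of the `N`-th power of the generic matrix. -/
noncomputable def powTrace (ι R : Type*) [Fintype ι] [CommRing R] (N : ℕ) :
    MvPolynomial (ι × ι) R :=
  open Classical in Matrix.trace (Matrix.mvPolynomialX ι ι R ^ N)

/-- The product of the row operators has the product of the row polynomials as its symbol, and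
applying it and taking the constant coefficient is pairing with that symbol. From here on only
coefficients of tr(A^N) matter. -/
theorem trace_eq_apolar [DecidableEq ι] (d : ℕ) (A : HTensor k ι R) :
    trace d A = ((k : R) - 1) ^ (Fintype.card ι - 1) *
      ∑ δ ∈ Finset.piAntidiag (Finset.univ : Finset ι) d,
        (∏ i, ((Nat.factorial (δ i * (k - 1)) : R)⁻¹)) *
          apolar (powTrace ι R (d * (k - 1))) (∏ i, rowPoly A i ^ δ i) := by
  classical
  rw [trace]
  congr 1
  refine Finset.sum_congr (by congr!) fun δ _ => ?_
  have h := IsSymbol.noncommProd Finset.univ (rowOp_pairwise A δ)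
    (fun i _ => ((isSymbol_rowOp A i).pow (δ i)).smul ((Nat.factorial (δ i * (k - 1)) : R)⁻¹))
  exact (h.constantCoeff _).trans (by rw [Finset.prod_smul, map_smul, smul_eq_mul, powTrace])

theorem rename_mvPolynomialX_pow [DecidableEq ι] [DecidableEq κ] (e : ι ≃ κ) (N : ℕ) (u v : ι) :
    rename (Prod.map e e) ((Matrix.mvPolynomialX ι ι R ^ N) u v)
      = (Matrix.mvPolynomialX κ κ R ^ N) (e u) (e v) := by
  induction N generalizing u v with
  | zero => simp [Matrix.one_apply, apply_ite]
  | succ N ih =>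
    rw [pow_succ, pow_succ, Matrix.mul_apply, Matrix.mul_apply, map_sum, ← e.sum_comp]
    refine Finset.sum_congr rfl fun w _ => ?_
    rw [map_mul, ih]
    simp [Matrix.mvPolynomialX]

theorem rename_powTrace (e : ι ≃ κ) (N : ℕ) :
    rename (Prod.map e e) (powTrace ι R N) = powTrace κ R N := by
  classical
  simp only [powTrace, Matrix.trace, Matrix.diag, map_sum]
  rw [← e.sum_comp]
  exact Finset.sum_congr rfl fun w _ => rename_mvPolynomialX_pow e N w w

/-- The trace is invariant under relabelling of the indices. -/
theorem trace_reindex (e : ι ≃ κ) (d : ℕ) (A : HTensor k ι R) (B : HTensor k κ R)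
    (h : ∀ i x, A i x = B (e i) (e ∘ x)) : trace d A = trace d B := by
  classical
  have hrow (i : ι) : rename (Prod.map e e) (rowPoly A i) = rowPoly B (e i) := by
    rw [rowPoly, rowPoly, map_sum, ← (Equiv.arrowCongr (Equiv.refl (Fin (k - 1))) e).sum_comp]
    refine Finset.sum_congr (by congr!) fun x _ => ?_
    rw [map_smul, map_prod]
    simp [h, Function.comp_def, Equiv.arrowCongr]
  rw [trace_eq_apolar, trace_eq_apolar, Fintype.card_congr e]
  congr 1
  refine Finset.sum_bij' (fun δ _ => δ ∘ e.symm) (fun δ _ => δ ∘ e) ?_ ?_ ?_ ?_ ?_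
  · intro δ hδ
    rw [Finset.mem_piAntidiag] at hδ ⊢
    exact ⟨by rw [← hδ.1]; exact e.symm.sum_comp δ, by simp⟩
  · intro δ hδ
    rw [Finset.mem_piAntidiag] at hδ ⊢
    exact ⟨by rw [← hδ.1]; exact e.sum_comp δ, by simp⟩
  · intro δ _; ext; simp
  · intro δ _; ext; simp
  · intro δ _
    rw [← rename_powTrace e, ← e.prod_comp, ← e.prod_comp (fun i => rowPoly B i ^ _)]
    simp only [Function.comp_apply, Equiv.symm_apply_apply, ← hrow, ← map_pow, ← map_prod]
    rw [apolar_rename (e.injective.prodMap e.injective)]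

end HTensor

/-! ### Coefficients of tr(A^N) as numbers of closed walks -/

namespace HTensor

open MvPolynomial

variable {ι : Type*} [DecidableEq ι]

/-- The arcs of the complete digraph on `S`, together with `c u` loops at each `u ∈ S`. -/
noncomputable def completeArcs (S : Finset ι) (c : ι → ℕ) : ι × ι →₀ ℕ :=
  ∑ u ∈ S, ∑ v ∈ S, Finsupp.single (u, v) (if u = v then c u else 1)

theorem completeArcs_insert {S : Finset ι} {z : ι} (hz : z ∉ S) (c : ι → ℕ) :
    completeArcs (insert z S) c = completeArcs S c + Finsupp.single (z, z) (c z) +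
      ∑ u ∈ S, (Finsupp.single (z, u) 1 + Finsupp.single (u, z) 1) := by
  have h1 : ∑ v ∈ S, Finsupp.single (z, v) (if z = v then c z else 1)
      = ∑ v ∈ S, Finsupp.single (z, v) 1 :=
    Finset.sum_congr rfl fun v hv => by rw [if_neg]; rintro rfl; exact hz hv
  have h2 : ∑ u ∈ S, Finsupp.single (u, z) (if u = z then c u else 1)
      = ∑ u ∈ S, Finsupp.single (u, z) 1 :=
    Finset.sum_congr rfl fun v hv => by rw [if_neg]; rintro rfl; exact hz hv
  simp only [completeArcs, Finset.sum_insert hz, Finset.sum_add_distrib, h1, h2, if_true]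
  abel

variable [Fintype ι]

/-- Removing the last arc (w, v) of a walk; this recursion drives all inductions on walks. -/
theorem coeff_mvPolynomialX_pow_succ {R : Type*} [CommRing R] (M : ι × ι →₀ ℕ) (N : ℕ) (u v : ι) :
    coeff M ((Matrix.mvPolynomialX ι ι R ^ (N + 1)) u v) =
      ∑ w, if (w, v) ∈ M.support then
        coeff (M - Finsupp.single (w, v) 1) ((Matrix.mvPolynomialX ι ι R ^ N) u w) else 0 := by
  rw [pow_succ, Matrix.mul_apply, coeff_sum]
  refine Finset.sum_congr rfl fun w _ => ?_
  rw [Matrix.mvPolynomialX_apply, coeff_mul_X']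

theorem exists_of_coeff_pow_succ_ne_zero {R : Type*} [CommRing R] {M : ι × ι →₀ ℕ} {N : ℕ}
    {u v : ι} (h : coeff M ((Matrix.mvPolynomialX ι ι R ^ (N + 1)) u v) ≠ 0) :
    ∃ w M', M = M' + Finsupp.single (w, v) 1 ∧
      coeff M' ((Matrix.mvPolynomialX ι ι R ^ N) u w) ≠ 0 := by
  rw [coeff_mvPolynomialX_pow_succ] at h
  obtain ⟨w, -, hw⟩ := Finset.exists_ne_zero_of_sum_ne_zero h
  split_ifs at hw with hs
  · refine ⟨w, _, ?_, hw⟩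
    rw [tsub_add_cancel_of_le]
    exact Finsupp.single_le_iff.2 (Nat.one_le_iff_ne_zero.2 (Finsupp.mem_support_iff.1 hs))
  · exact absurd rfl hw

theorem eq_of_coeff_pow_zero_ne_zero {R : Type*} [CommRing R] {M : ι × ι →₀ ℕ}
    {u v : ι} (h : coeff M ((Matrix.mvPolynomialX ι ι R ^ 0) u v) ≠ 0) : M = 0 ∧ u = v := by
  rw [pow_zero, Matrix.one_apply] at h
  split_ifs at h with huv
  · rw [coeff_one] at h
    exact ⟨by by_contra h'; exact h (if_neg (Ne.symm h')), huv⟩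
  · simp at h

/-- The arcs of a walk from `u` to `v` leave and enter every other vertex equally often. -/
theorem balanced_of_coeff_pow_ne_zero {R : Type*} [CommRing R] {M : ι × ι →₀ ℕ} {N : ℕ} {u v : ι}
    (h : coeff M ((Matrix.mvPolynomialX ι ι R ^ N) u v) ≠ 0) (w : ι) :
    (∑ x, M (w, x)) + (if w = v then 1 else 0) = (∑ x, M (x, w)) + if w = u then 1 else 0 := by
  induction N generalizing M v with
  | zero => obtain ⟨rfl, rfl⟩ := eq_of_coeff_pow_zero_ne_zero h; simp
  | succ N ih =>
    obtain ⟨z, M', rfl, hM⟩ := exists_of_coeff_pow_succ_ne_zero h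
    have := ih hM
    simp only [Finsupp.add_apply, Finset.sum_add_distrib, Finsupp.single_apply, Prod.mk.injEq]
    have h1 : (∑ x, if z = w ∧ v = x then 1 else 0) = if w = z then 1 else 0 := by
      by_cases hz : z = w <;> simp [hz, eq_comm (a := w)]
    have h2 : (∑ x, if z = x ∧ v = w then 1 else 0) = if w = v then 1 else 0 := by
      by_cases hz : v = w <;> simp [hz, eq_comm (a := w)]
    rw [h1, h2]
    omega

/-- A walk that starts in a set which none of its arcs leaves or enters stays in that set. -/
theorem mem_of_coeff_pow_ne_zero {R : Type*} [CommRing R] {M : ι × ι →₀ ℕ} {N : ℕ} {u v : ι}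
    (h : coeff M ((Matrix.mvPolynomialX ι ι R ^ N) u v) ≠ 0) (C : Set ι)
    (hC : ∀ x y, M (x, y) ≠ 0 → (x ∈ C ↔ y ∈ C)) (hu : u ∈ C) :
    v ∈ C ∧ ∀ x y, M (x, y) ≠ 0 → x ∈ C := by
  induction N generalizing M v with
  | zero => obtain ⟨rfl, rfl⟩ := eq_of_coeff_pow_zero_ne_zero h; simpa using hu
  | succ N ih =>
    obtain ⟨z, M', rfl, hM⟩ := exists_of_coeff_pow_succ_ne_zero h
    obtain ⟨hz, harc⟩ := ih hM fun x y hxy => hC x y (by simp [hxy])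
    refine ⟨(hC z v (by simp)).1 hz, fun x y hxy => ?_⟩
    by_cases hxy' : M' (x, y) = 0
    · have : (z, v) = (x, y) := by
        by_contra hne
        simp [hxy', hne] at hxy
      rw [← (Prod.mk.inj this).1]
      exact hz
    · exact harc x y hxy'

theorem coeff_powTrace {R : Type*} [CommRing R] (M : ι × ι →₀ ℕ) (N : ℕ) :
    coeff M (powTrace ι R N) = ∑ u, coeff M ((Matrix.mvPolynomialX ι ι R ^ N) u u) := by
  simp only [powTrace, Matrix.trace, Matrix.diag, coeff_sum]
  refine Finset.sum_congr rfl fun u _ => ?_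
  congr!

theorem exists_coeff_ne_zero_of_powTrace {R : Type*} [CommRing R] {M : ι × ι →₀ ℕ} {N : ℕ}
    (h : coeff M (powTrace ι R N) ≠ 0) :
    ∃ u, coeff M ((Matrix.mvPolynomialX ι ι R ^ N) u u) ≠ 0 := by
  rw [coeff_powTrace] at h
  obtain ⟨w, -, hw⟩ := Finset.exists_ne_zero_of_sum_ne_zero h
  exact ⟨w, hw⟩

theorem balanced_of_coeff_powTrace_ne_zero {R : Type*} [CommRing R] {M : ι × ι →₀ ℕ} {N : ℕ}
    (h : coeff M (powTrace ι R N) ≠ 0) (w : ι) : ∑ x, M (w, x) = ∑ x, M (x, w) := by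
  obtain ⟨u, hu⟩ := exists_coeff_ne_zero_of_powTrace h
  simpa using balanced_of_coeff_pow_ne_zero hu w

/-- A closed walk has a single starting point, and it cannot cross the boundary of C. This is the
form in which connectedness of the arc multiset is used. -/
theorem mem_or_notMem_of_coeff_powTrace_ne_zero {R : Type*} [CommRing R] {M : ι × ι →₀ ℕ} {N : ℕ}
    (h : coeff M (powTrace ι R N) ≠ 0) (C : Set ι)
    (hC : ∀ x y, M (x, y) ≠ 0 → (x ∈ C ↔ y ∈ C)) :
    (∀ x y, M (x, y) ≠ 0 → x ∈ C) ∨ ∀ x y, M (x, y) ≠ 0 → x ∉ C := by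
  obtain ⟨u, hu⟩ := exists_coeff_ne_zero_of_powTrace h
  by_cases huC : u ∈ C
  · exact .inl (mem_of_coeff_pow_ne_zero hu C hC huC).2
  · exact .inr (mem_of_coeff_pow_ne_zero hu Cᶜ (fun x y hxy => (hC x y hxy).not) huC).2

theorem coeff_pow_nonneg (M : ι × ι →₀ ℕ) (N : ℕ) (u v : ι) :
    0 ≤ coeff M ((Matrix.mvPolynomialX ι ι ℝ ^ N) u v) := by
  induction N generalizing M v with
  | zero =>
    rw [pow_zero, Matrix.one_apply]
    split_ifs
    · rw [coeff_one]; split_ifs <;> simp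
    · simp
  | succ N ih =>
    rw [coeff_mvPolynomialX_pow_succ]
    refine Finset.sum_nonneg fun w _ => ?_
    split_ifs
    · exact ih _ _
    · exact le_rfl

/-- `M` is the arc multiset of a walk from `u` to `v`. -/
def IsWalk (M : ι × ι →₀ ℕ) (u v : ι) : Prop :=
  0 < coeff M ((Matrix.mvPolynomialX ι ι ℝ ^ M.degree) u v)

namespace IsWalk

theorem nil (u : ι) : IsWalk 0 u u := by simp [IsWalk]

theorem arc (u v : ι) : IsWalk (Finsupp.single (u, v) 1) u v := by
  simp [IsWalk]

theorem append {M M' : ι × ι →₀ ℕ} {u v w : ι} (h : IsWalk M u v) (h' : IsWalk M' v w) :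
    IsWalk (M + M') u w := by
  unfold IsWalk at *
  rw [map_add, pow_add, Matrix.mul_apply, coeff_sum]
  refine (Finset.sum_pos' (fun x _ => ?_) ⟨v, Finset.mem_univ _, ?_⟩)
  · rw [coeff_mul]
    exact Finset.sum_nonneg fun _ _ => mul_nonneg (coeff_pow_nonneg _ _ _ _)
      (coeff_pow_nonneg _ _ _ _)
  · rw [coeff_mul]
    exact Finset.sum_pos' (fun _ _ => mul_nonneg (coeff_pow_nonneg _ _ _ _)
      (coeff_pow_nonneg _ _ _ _)) ⟨(M, M'), by simp, mul_pos h h'⟩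

theorem loops (u : ι) (n : ℕ) : IsWalk (Finsupp.single (u, u) n) u u := by
  induction n with
  | zero => simpa using nil u
  | succ n ih => rw [Finsupp.single_add]; exact ih.append (arc u u)

theorem sum {s : Finset ι} {M : ι → ι × ι →₀ ℕ} {u : ι} (h : ∀ x ∈ s, IsWalk (M x) u u) :
    IsWalk (∑ x ∈ s, M x) u u := by
  induction s using Finset.induction_on with
  | empty => simpa using nil u
  | insert a s ha ih =>
    rw [Finset.sum_insert ha]
    exact (h a (by simp)).append (ih fun j hj => h j (by simp [hj]))

theorem coeff_powTrace_pos {M : ι × ι →₀ ℕ} {u : ι} (h : IsWalk M u u) :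
    0 < coeff M (powTrace ι ℝ M.degree) := by
  rw [coeff_powTrace]
  exact Finset.sum_pos' (fun x _ => coeff_pow_nonneg M M.degree x x) ⟨u, Finset.mem_univ _, h⟩

end IsWalk

/-- Induction on S: a new vertex z is served by one excursion from r. Go to z, run the loops there,
visit each other u ∈ S and return to z at once, then go back to r. -/
theorem isWalk_completeArcs_insert {S : Finset ι} {r : ι} (hr : r ∉ S) (c : ι → ℕ) :
    IsWalk (completeArcs (insert r S) c) r r := by
  induction S using Finset.induction_on with
  | empty => simpa [completeArcs] using IsWalk.loops r (c r)
  | insert z S hz ih =>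
    rw [Finset.mem_insert, not_or] at hr
    have hz' : z ∉ insert r S := by simp [hz, Ne.symm hr.1]
    rw [Finset.insert_comm, completeArcs_insert hz', Finset.sum_insert hr.2]
    have hinner : IsWalk (Finsupp.single (z, z) (c z) +
        ∑ u ∈ S, (Finsupp.single (z, u) 1 + Finsupp.single (u, z) 1)) z z :=
      (IsWalk.loops z _).append (IsWalk.sum fun u _ => (IsWalk.arc z u).append (IsWalk.arc u z))
    have := (ih hr.2).append (((IsWalk.arc r z).append hinner).append (IsWalk.arc z r))
    convert this using 1
    abel

theorem isWalk_completeArcs {S : Finset ι} {r : ι} (hr : r ∈ S) (c : ι → ℕ) :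
    IsWalk (completeArcs S c) r r := by
  rw [← Finset.insert_erase hr]
  exact isWalk_completeArcs_insert (Finset.notMem_erase r S) c

/-- Exactly one walk uses only loops at i, so the coefficient is 1 and not merely positive. -/
theorem coeff_pow_loops (i u v : ι) (N : ℕ) :
    coeff (Finsupp.single (i, i) (N + 1)) ((Matrix.mvPolynomialX ι ι ℝ ^ (N + 1)) u v)
      = if u = i ∧ v = i then 1 else 0 := by
  induction N generalizing v with
  | zero =>
    rw [zero_add, pow_one, Matrix.mvPolynomialX_apply, coeff_X]
    simp [Finsupp.single_left_inj]
  | succ N ih =>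
    rw [coeff_mvPolynomialX_pow_succ, Finset.sum_eq_single i]
    · by_cases hv : v = i
      · subst hv
        rw [if_pos (by simp), Finsupp.single_add _ (N + 1) 1, add_tsub_cancel_right, ih]
      · rw [if_neg (by simp [Ne.symm hv]), if_neg (by simp [hv])]
    · intro w _ hw
      rw [if_neg]
      simp [Ne.symm hw]
    · simp

theorem coeff_powTrace_loops (i : ι) {N : ℕ} (hN : N ≠ 0) :
    coeff (Finsupp.single (i, i) N) (powTrace ι ℝ N) = 1 := by
  obtain ⟨N, rfl⟩ := Nat.exists_eq_succ_of_ne_zero hN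
  rw [coeff_powTrace]
  simp_rw [Nat.succ_eq_add_one, coeff_pow_loops]
  simp

end HTensor

/-! ### Multinomial expansion under the pairing -/

namespace MvPolynomial

variable {σ R : Type*} [CommSemiring R]

theorem prod_monomial {J : Type*} (s : Finset J) (m : J → σ →₀ ℕ) (c : J → R) :
    ∏ j ∈ s, monomial (m j) (c j) = monomial (∑ j ∈ s, m j) (∏ j ∈ s, c j) := by
  classical
  induction s using Finset.induction_on with
  | empty => simp
  | insert a s ha ih => rw [Finset.prod_insert ha, ih, monomial_mul, Finset.sum_insert ha,
      Finset.prod_insert ha]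

/-- Multinomial expansion of a product of powers of polynomials under the apolar pairing. -/
theorem apolar_prod_pow {J O : Type*} [Fintype J] [DecidableEq J] [Fintype O] [DecidableEq O]
    (f : MvPolynomial σ R) (m : J → O → σ →₀ ℕ) (c : J → O → R) (δ : J → ℕ) :
    apolar f (∏ j, (∑ o, monomial (m j o) (c j o)) ^ δ j) =
      ∑ a ∈ Fintype.piFinset fun j => Finset.piAntidiag (Finset.univ : Finset O) (δ j),
        (∏ j, ((Nat.multinomial Finset.univ (a j) : R) * ∏ o, c j o ^ a j o)) *
          apolar f (monomial (∑ j, ∑ o, a j o • m j o) 1) := by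
  have h (j : J) : (∑ o, monomial (m j o) (c j o)) ^ δ j =
      ∑ a ∈ Finset.piAntidiag (Finset.univ : Finset O) (δ j),
        monomial (∑ o, a o • m j o)
          ((Nat.multinomial Finset.univ a : R) * ∏ o, c j o ^ a o) := by
    rw [Finset.sum_pow_eq_sum_piAntidiag]
    refine Finset.sum_congr rfl fun a _ => ?_
    simp_rw [monomial_pow, prod_monomial]
    rw [← nsmul_eq_mul, ← nsmul_eq_mul, ← map_nsmul]
  simp_rw [h]
  rw [Finset.prod_univ_sum, map_sum]
  refine Finset.sum_congr rfl fun a _ => ?_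
  rw [prod_monomial, apolar_monomial, apolar_monomial, one_mul]

end MvPolynomial

/-! ### Row polynomials of the 𝓐_α-tensor -/

namespace HTensor

open MvPolynomial

variable {ι : Type*} [DecidableEq ι]

/-- The number of members of `E` that contain `v`. -/
def edgeDegree (E : Finset (Finset ι)) (v : ι) : ℕ := (E.filter (v ∈ ·)).card

/-- A tuple of k - 1 entries that covers the k - 1 vertices of `e.erase i` has no room for
repetitions, nor for i itself. -/
theorem prod_X_eq_of_image {k : ℕ} {e : Finset ι} {i : ι} (he : e.card = k) (hi : i ∈ e)
    {x : Fin (k - 1) → ι} (hx : insert i (Finset.univ.image x) = e) :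
    (∏ j, X (i, x j) : MvPolynomial (ι × ι) ℝ) = ∏ v ∈ e.erase i, X (i, v) := by
  have hsub : e.erase i ⊆ Finset.univ.image x := by
    rw [← hx]; exact Finset.erase_insert_subset _ _
  have hle : (Finset.univ.image x).card ≤ (e.erase i).card := by
    refine Finset.card_image_le.trans ?_
    simp [Finset.card_erase_of_mem hi, he]
  have himg : e.erase i = Finset.univ.image x := Finset.eq_of_subset_of_card_le hsub hle
  have hinj : Function.Injective x := by
    have : (Finset.univ.image x).card = (Finset.univ : Finset (Fin (k - 1))).card := by
      rw [← himg]; simp [Finset.card_erase_of_mem hi, he]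
    simpa using Finset.card_image_iff.1 this
  rw [himg, Finset.prod_image fun a _ b _ h => hinj h]

variable [Fintype ι]

/-- The tensor `α 𝓓 + (1 - α) 𝓐` of the hypergraph with edges `E`. -/
noncomputable def edgeTensor (k : ℕ) (E : Finset (Finset ι)) (α : ℝ) : HTensor k ι ℝ := fun i x =>
  α * (if ∀ j, x j = i then (edgeDegree E i : ℝ) else 0) +
    (1 - α) * (if insert i (Finset.univ.image x) ∈ E then 1 / (Nat.factorial (k - 1) : ℝ) else 0)

/-- The arcs of the summands of the row polynomial of an `edgeTensor`. -/
noncomputable def optionArcs (k : ℕ) (E : Finset (Finset ι)) (i : ι) : Option E → ι × ι →₀ ℕ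
  | none => Finsupp.single (i, i) (k - 1)
  | some e => ∑ j ∈ e.1.erase i, Finsupp.single (i, j) 1

/-- The coefficients of the summands of the row polynomial of an `edgeTensor`. -/
noncomputable def optionCoeff (E : Finset (Finset ι)) (α : ℝ) (i : ι) : Option E → ℝ
  | none => α * edgeDegree E i
  | some e => if i ∈ e.1 then 1 - α else 0

/-- The tuples are the bijections onto `e.erase i`. Their number cancels the factor 1/(k-1)! of the
adjacency tensor. -/
theorem card_image_eq_erase {k : ℕ} {e : Finset ι} {i : ι} (he : e.card = k) (hi : i ∈ e) :
    (Finset.univ.filter fun x : Fin (k - 1) → ι => insert i (Finset.univ.image x) = e).card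
      = (k - 1).factorial := by
  have hcard : Fintype.card (Fin (k - 1)) = Fintype.card (e.erase i) := by
    rw [Fintype.card_fin, Fintype.card_coe, Finset.card_erase_of_mem hi, he]
  have hfact : (k - 1).factorial = (Finset.univ : Finset (Fin (k - 1) ≃ e.erase i)).card := by
    rw [Finset.card_univ, Fintype.card_equiv (Fintype.equivOfCardEq hcard), Fintype.card_fin]
  rw [hfact]
  symm
  refine Finset.card_bij (fun g _ j => (g j : ι)) ?_ ?_ ?_
  · intro g _
    simp only [Finset.mem_filter, Finset.mem_univ, true_and]
    have : Finset.univ.image (fun j => (g j : ι)) = e.erase i := by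
      ext v
      simp only [Finset.mem_image, Finset.mem_univ, true_and]
      constructor
      · rintro ⟨j, rfl⟩; exact (g j).2
      · intro hv; exact ⟨g.symm ⟨v, hv⟩, by simp⟩
    rw [this, Finset.insert_erase hi]
  · intro g _ g' _ h
    ext j
    exact congrFun h j
  · intro x hx
    simp only [Finset.mem_filter, Finset.mem_univ, true_and] at hx
    have hsub : e.erase i ⊆ Finset.univ.image x := by
      rw [← hx]; exact Finset.erase_insert_subset _ _
    have himg : Finset.univ.image x = e.erase i := by
      refine (Finset.eq_of_subset_of_card_le hsub ?_).symm
      refine Finset.card_image_le.trans ?_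
      simp [Finset.card_erase_of_mem hi, he]
    have hmem (j) : x j ∈ e.erase i := by rw [← himg]; simp
    let g : Fin (k - 1) → e.erase i := fun j => ⟨x j, hmem j⟩
    have hsurj : Function.Surjective g := by
      rintro ⟨v, hv⟩
      rw [← himg] at hv
      obtain ⟨j, -, rfl⟩ := Finset.mem_image.1 hv
      exact ⟨j, rfl⟩
    exact ⟨Equiv.ofBijective g ((Fintype.bijective_iff_surjective_and_card g).2 ⟨hsurj, hcard⟩),
      Finset.mem_univ _, rfl⟩

theorem rowPoly_edgeTensor {k : ℕ} {E : Finset (Finset ι)}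
    (hE : ∀ e ∈ E, e.card = k) (α : ℝ) (i : ι) :
    rowPoly (edgeTensor k E α) i =
      ∑ o, monomial (optionArcs k E i o) (optionCoeff E α i o) := by
  rw [Fintype.sum_option, rowPoly]
  simp only [edgeTensor, add_smul, Finset.sum_add_distrib]
  congr 1
  · rw [Finset.sum_eq_single fun _ => i]
    · simp only [optionArcs, optionCoeff, implies_true, if_true, Finset.prod_const, Finset.card_univ,
        Fintype.card_fin, X_pow_eq_monomial, smul_monomial, smul_eq_mul, mul_one]
    · intro x _ hx
      rw [if_neg fun h => hx (funext h)]
      simp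
    · simp
  · have hterm (x : Fin (k - 1) → ι) :
        (((1 - α) * if insert i (Finset.univ.image x) ∈ E then
          1 / (Nat.factorial (k - 1) : ℝ) else 0) • ∏ j, X (i, x j) : MvPolynomial (ι × ι) ℝ) =
        ∑ e : E, if insert i (Finset.univ.image x) = e.1 then
          ((1 - α) * (1 / (Nat.factorial (k - 1) : ℝ))) • ∏ v ∈ e.1.erase i, X (i, v) else 0 := by
      by_cases hx : insert i (Finset.univ.image x) ∈ E
      · rw [if_pos hx, Finset.sum_eq_single ⟨_, hx⟩, if_pos rfl,
          prod_X_eq_of_image (hE _ hx) (by simp) rfl]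
        · rintro e - hne
          rw [if_neg]
          rintro h
          exact hne (Subtype.ext h.symm)
        · simp
      · rw [if_neg hx, mul_zero, zero_smul, Finset.sum_eq_zero]
        rintro e -
        rw [if_neg]
        intro h
        exact hx (h ▸ e.2)
    rw [Finset.sum_congr (by congr!) fun x _ => hterm x, Finset.sum_comm]
    refine Finset.sum_congr rfl fun e _ => ?_
    rw [← Finset.sum_filter, Finset.sum_const]
    by_cases hi : i ∈ e.1
    · rw [card_image_eq_erase (hE _ e.2) hi, ← Nat.cast_smul_eq_nsmul ℝ, smul_smul]
      have : (Nat.factorial (k - 1) : ℝ) ≠ 0 := by positivity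
      rw [optionArcs, optionCoeff, if_pos hi]
      have h2 : ∏ v ∈ e.1.erase i, (X (i, v) : MvPolynomial (ι × ι) ℝ) =
          monomial (∑ j ∈ e.1.erase i, Finsupp.single (i, j) 1) 1 := by
        simp only [X]
        rw [prod_monomial, Finset.prod_const_one]
      rw [h2, smul_monomial, smul_eq_mul, mul_one]
      congr 1
      field_simp
    · rw [optionCoeff, if_neg hi, map_zero, Finset.filter_false_of_mem]
      · simp
      · intro x _ h
        exact hi (h ▸ Finset.mem_insert_self _ _)

end HTensor

/-! ### Contributing choices of summands in a hypertree -/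

namespace HTensor

open MvPolynomial

/-- Every incident pair `v ∈ e` is a cut: some set meets `e` in `v` only, and contains or avoids
each of the other edges. -/
def HasCuts {ι : Type*} [DecidableEq ι] (E : Finset (Finset ι)) : Prop :=
  ∀ e ∈ E, ∀ v ∈ e, ∃ C : Finset ι, C ∩ e = {v} ∧ ∀ f ∈ E, f ≠ e → f ⊆ C ∨ Disjoint f C

section

variable {ι : Type*} [DecidableEq ι] {k : ℕ} {E : Finset (Finset ι)}

/-- A balanced family of nonnegative weights on the incident pairs of a hypertree is constant on
every edge. -/
theorem HasCuts.weight_eq (hcut : HasCuts E) (hE : ∀ e ∈ E, e.card = k) (b : ι → E → ℤ)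
    (hb : ∀ w, ∑ e : E, (if w ∈ e.1 then k * b w e - ∑ x ∈ e.1, b x e else 0) = 0)
    (e : E) {v : ι} (hv : v ∈ e.1) : k * b v e = ∑ x ∈ e.1, b x e := by
  obtain ⟨C, hCe, hC⟩ := hcut e.1 e.2 v hv
  -- The summand at w is the net flow out of w through the edge. Summed over C, the flows through an
  -- edge inside C cancel because it has k vertices, and an edge disjoint from C contributes
  -- nothing. Only the flow of e at v survives, since C meets e in v alone.
  have h0 : ∑ w ∈ C, ∑ f : E, (if w ∈ f.1 then k * b w f - ∑ x ∈ f.1, b x f else 0) = 0 :=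
    Finset.sum_eq_zero fun w _ => hb w
  rw [Finset.sum_comm, Finset.sum_eq_single e, ← Finset.sum_filter, Finset.filter_mem_eq_inter, hCe,
    Finset.sum_singleton, sub_eq_zero] at h0
  · exact h0
  · intro f _ hf
    rw [← Finset.sum_filter, Finset.filter_mem_eq_inter]
    rcases hC f.1 f.2 fun h => hf (Subtype.ext h) with h | h
    · rw [Finset.inter_eq_right.2 h, Finset.sum_sub_distrib, ← Finset.mul_sum, Finset.sum_const,
        hE _ f.2, nsmul_eq_mul, sub_self]
    · rw [Finset.disjoint_iff_inter_eq_empty.1 h.symm, Finset.sum_empty]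
  · simp

theorem optionArcs_none_apply (i x y : ι) :
    optionArcs k E i none (x, y) = if i = x ∧ x = y then k - 1 else 0 := by
  rw [optionArcs, Finsupp.single_apply]
  refine if_congr ?_ rfl rfl
  rw [Prod.mk.injEq]
  constructor
  · rintro ⟨rfl, rfl⟩; exact ⟨rfl, rfl⟩
  · rintro ⟨rfl, rfl⟩; exact ⟨rfl, rfl⟩

theorem optionArcs_some_apply (i x y : ι) (e : E) :
    optionArcs k E i (some e) (x, y) = if i = x then (if y ∈ e.1.erase x then 1 else 0) else 0 := by
  rw [optionArcs, Finsupp.finsetSum_apply]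
  simp only [Finsupp.single_apply, Prod.mk.injEq]
  by_cases h : i = x
  · subst h
    simp
  · simp [h]

variable [Fintype ι]

/-- The arc multiset of a choice of summands of the row polynomials. -/
noncomputable def choiceArcs (k : ℕ) (E : Finset (Finset ι)) (a : ι → Option E → ℕ) : ι × ι →₀ ℕ :=
  ∑ i, ∑ o, a i o • optionArcs k E i o

theorem choiceArcs_apply (a : ι → Option E → ℕ) (x y : ι) :
    choiceArcs k E a (x, y) = a x none * (if x = y then k - 1 else 0) +
      ∑ e : E, a x (some e) * (if y ∈ e.1.erase x then 1 else 0) := by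
  simp only [choiceArcs, Finsupp.finsetSum_apply, Fintype.sum_option, Finsupp.add_apply,
    Finsupp.smul_apply, smul_eq_mul, optionArcs_none_apply, optionArcs_some_apply]
  rw [Finset.sum_eq_single x]
  · simp
  · intro i _ hi
    simp [hi]
  · simp

theorem choiceArcs_row (hE : ∀ e ∈ E, e.card = k) {a : ι → Option E → ℕ}
    (ha : ∀ i (e : E), i ∉ e.1 → a i (some e) = 0) (x : ι) :
    ∑ y, choiceArcs k E a (x, y) =
      a x none * (k - 1) + ∑ e : E, if x ∈ e.1 then a x (some e) * (k - 1) else 0 := by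
  simp only [choiceArcs_apply, Finset.sum_add_distrib]
  congr 1
  · simp
  · rw [Finset.sum_comm]
    refine Finset.sum_congr rfl fun e _ => ?_
    rw [← Finset.mul_sum]
    split_ifs with hx
    · rw [← Finset.sum_filter, Finset.filter_mem_eq_inter, Finset.univ_inter, ← Finset.card_eq_sum_ones,
        Finset.card_erase_of_mem hx, hE _ e.2]
    · rw [ha x e hx, zero_mul]

theorem choiceArcs_col {a : ι → Option E → ℕ}
    (ha : ∀ i (e : E), i ∉ e.1 → a i (some e) = 0) (y : ι) :
    ∑ x, choiceArcs k E a (x, y) =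
      a y none * (k - 1) + ∑ e : E, if y ∈ e.1 then ∑ x ∈ e.1.erase y, a x (some e) else 0 := by
  simp only [choiceArcs_apply, Finset.sum_add_distrib]
  congr 1
  · simp
  · rw [Finset.sum_comm]
    refine Finset.sum_congr rfl fun e _ => ?_
    by_cases hy : y ∈ e.1
    · rw [if_pos hy, ← Finset.sum_subset (Finset.subset_univ (e.1.erase y))]
      · refine Finset.sum_congr rfl fun x hx => ?_
        rw [if_pos, mul_one]
        exact Finset.mem_erase.2 ⟨(Finset.ne_of_mem_erase hx).symm, hy⟩
      · intro x _ hx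
        rw [Finset.mem_erase, not_and'] at hx
        by_cases hxe : x ∈ e.1
        · rw [if_neg, mul_zero]
          simp [not_not.1 (hx hxe)]
        · rw [ha x e hxe, zero_mul]
    · rw [if_neg hy]
      refine Finset.sum_eq_zero fun x _ => ?_
      rw [if_neg, mul_zero]
      exact fun h => hy (Finset.mem_of_mem_erase h)

/-- In a contributing choice, all vertices of an edge use it equally often. -/
theorem choice_weight_eq (hk : 1 ≤ k) (hcut : HasCuts E) (hE : ∀ e ∈ E, e.card = k)
    {a : ι → Option E → ℕ} (ha : ∀ i (e : E), i ∉ e.1 → a i (some e) = 0) {N : ℕ}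
    (hne : coeff (choiceArcs k E a) (powTrace ι ℝ N) ≠ 0) (e : E) {v : ι} (hv : v ∈ e.1) :
    k * a v (some e) = ∑ x ∈ e.1, a x (some e) := by
  -- Outgoing minus incoming arcs at w. Through e this is (k-1) a_w minus the sum of a_x over the
  -- other x ∈ e, that is k a_w minus the full sum; the loops cancel.
  have hb (w : ι) : ∑ e : E, (if w ∈ e.1 then (k : ℤ) * (a w (some e) : ℤ) -
      ∑ x ∈ e.1, (a x (some e) : ℤ) else 0) = 0 := by
    have h := balanced_of_coeff_powTrace_ne_zero hne w
    rw [choiceArcs_row hE ha, choiceArcs_col ha, add_right_inj] at h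
    have h' : ∑ e : E, (((if w ∈ e.1 then a w (some e) * (k - 1) else 0 : ℕ) : ℤ) -
        ((if w ∈ e.1 then ∑ x ∈ e.1.erase w, a x (some e) else 0 : ℕ) : ℤ)) = 0 := by
      rw [Finset.sum_sub_distrib, sub_eq_zero]
      exact_mod_cast h
    refine (Finset.sum_congr rfl fun e _ => ?_).trans h'
    split_ifs with hw
    · rw [← Finset.add_sum_erase _ _ hw]
      push_cast [hk]
      ring
    · simp
  have := hcut.weight_eq hE (fun v e => (a v (some e) : ℤ)) hb e hv
  exact_mod_cast this

/-- In a contributing choice of fewer than `2 * k` summands, either only loops at a single vertex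
are used, or a single edge is used once by each of its vertices, together with loops at these. -/
theorem choice_classification (hk : 2 ≤ k) (hcut : HasCuts E) (hE : ∀ e ∈ E, e.card = k)
    {δ : ι → ℕ} (hδ0 : δ ≠ 0) (hδ : ∑ i, δ i < 2 * k)
    {a : ι → Option E → ℕ} (haδ : ∀ i, ∑ o, a i o = δ i)
    (ha : ∀ i (e : E), i ∉ e.1 → a i (some e) = 0) {N : ℕ}
    (hne : coeff (choiceArcs k E a) (powTrace ι ℝ N) ≠ 0) :
    (∃ i, (∀ j, j ≠ i → δ j = 0) ∧ ∀ j, a j = Pi.single none (δ j)) ∨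
      ∃ e : E, (∀ i, δ i ≠ 0 ↔ i ∈ e.1) ∧
        ∀ i, a i = if i ∈ e.1 then Pi.single none (δ i - 1) + Pi.single (some e) 1 else 0 := by
  have hw := fun e v hv => choice_weight_eq (by omega) hcut hE ha hne e (v := v) hv
  have hsum : ∑ e : E, ∑ x ∈ e.1, a x (some e) ≤ ∑ i, δ i := by
    calc ∑ e : E, ∑ x ∈ e.1, a x (some e) ≤ ∑ e : E, ∑ x, a x (some e) :=
          Finset.sum_le_sum fun e _ => Finset.sum_le_sum_of_subset (Finset.subset_univ _)
      _ = ∑ x, ∑ e : E, a x (some e) := Finset.sum_comm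
      _ ≤ ∑ i, δ i := by
          refine Finset.sum_le_sum fun i _ => ?_
          rw [← haδ i, Fintype.sum_option]
          exact Nat.le_add_left _ _
  by_cases hall : ∀ v (e : E), a v (some e) = 0
  · left
    obtain ⟨i, hi⟩ := Function.ne_iff.1 hδ0
    have haj (j : ι) : a j = Pi.single none (δ j) := by
      funext o
      rcases o with _ | e
      · rw [← haδ j, Fintype.sum_option]; simp [hall]
      · simp [hall]
    refine ⟨i, fun j hj => ?_, haj⟩
    have harc (x y : ι) : choiceArcs k E a (x, y) = δ x * if x = y then k - 1 else 0 := by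
      rw [choiceArcs_apply]; simp [haj]
    -- With loops only, no arc leaves {i}, so the closed walk never visits a second vertex.
    rcases mem_or_notMem_of_coeff_powTrace_ne_zero hne {i} (fun x y hxy => by
      rw [harc] at hxy
      by_cases h : x = y
      · rw [h]
      · simp [h] at hxy) with h | h
    · by_contra hj0
      exact hj (h j j (by rw [harc]; simp [hj0]; omega))
    · exact absurd rfl (h i i (by rw [harc]; simp at hi; simp [hi]; omega))
  · right
    push Not at hall
    obtain ⟨v, e, hve⟩ := hall
    have hv : v ∈ e.1 := by by_contra h; exact hve (ha v e h)
    have hSv := hw e v hv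
    have hSe : ∑ x ∈ e.1, a x (some e) ≤ ∑ e : E, ∑ x ∈ e.1, a x (some e) :=
      Finset.single_le_sum (f := fun e : E => ∑ x ∈ e.1, a x (some e)) (fun _ _ => Nat.zero_le _)
        (Finset.mem_univ e)
    -- The common multiplicity c ≥ 1 of e takes up kc of the fewer than 2k summands, so c = 1.
    have hone (x) (hx : x ∈ e.1) : a x (some e) = 1 := by
      have h1 := hw e x hx
      have h2 : k * a x (some e) = k * a v (some e) := h1.trans hSv.symm
      have h3 : a x (some e) = a v (some e) := Nat.eq_of_mul_eq_mul_left (by omega) h2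
      have h4 : a v (some e) < 2 := by
        by_contra h
        have : k * 2 ≤ k * a v (some e) := Nat.mul_le_mul_left _ (by omega)
        omega
      omega
    -- A second edge would need k further summands, making at least 2k in all.
    have hother (f : E) (hf : f ≠ e) (x) : a x (some f) = 0 := by
      by_contra h
      have hx : x ∈ f.1 := by by_contra h'; exact h (ha x f h')
      have h1 := hw f x hx
      have h2 : k * 1 ≤ k * a x (some f) := Nat.mul_le_mul_left _ (by omega)
      have h3 : k * 1 ≤ k * a v (some e) := Nat.mul_le_mul_left _ (by omega)
      have h4 := Finset.add_sum_erase Finset.univ (fun e : E => ∑ x ∈ e.1, a x (some e))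
        (Finset.mem_univ e)
      have h5 := Finset.single_le_sum (f := fun e : E => ∑ x ∈ e.1, a x (some e))
        (fun _ _ => Nat.zero_le _) (Finset.mem_erase.2 ⟨hf, Finset.mem_univ f⟩)
      omega
    have hcross (x y : ι) : choiceArcs k E a (x, y) = a x none * (if x = y then k - 1 else 0) +
        a x (some e) * (if y ∈ e.1.erase x then 1 else 0) := by
      rw [choiceArcs_apply, Finset.sum_eq_single e]
      · intro f _ hf; rw [hother f hf, zero_mul]
      · simp
    -- All arcs other than loops run inside e, so connectedness excludes loops at vertices outside
    -- e.
    have hin : ∀ x y, choiceArcs k E a (x, y) ≠ 0 → x ∈ e.1 := by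
      refine (mem_or_notMem_of_coeff_powTrace_ne_zero hne (e.1 : Set ι) fun x y hxy => ?_).resolve_right
        fun h => ?_
      · rw [hcross] at hxy
        by_cases h : x = y
        · rw [h]
        · rw [if_neg h, mul_zero, zero_add] at hxy
          have hx : x ∈ e.1 := by by_contra h'; rw [ha x e h', zero_mul] at hxy; exact hxy rfl
          have hy : y ∈ e.1.erase x := by by_contra h'; rw [if_neg h', mul_zero] at hxy; exact hxy rfl
          exact iff_of_true hx (Finset.mem_of_mem_erase hy)
      · obtain ⟨y, hy⟩ : (e.1.erase v).Nonempty := by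
          rw [← Finset.card_pos, Finset.card_erase_of_mem hv, hE _ e.2]; omega
        refine h v y ?_ hv
        rw [hcross, if_pos hy, hone v hv]
        omega
    have hloop (x) (hx : x ∉ e.1) : a x none = 0 := by
      by_contra h
      refine hx (hin x x ?_)
      rw [hcross, if_pos rfl]
      have : 0 < a x none * (k - 1) := Nat.mul_pos (by omega) (by omega)
      omega
    have hai (i : ι) : δ i = a i none + a i (some e) := by
      rw [← haδ i, Fintype.sum_option, Finset.sum_eq_single e]
      · intro f _ hf; exact hother f hf i
      · simp
    refine ⟨e, fun i => ?_, fun i => ?_⟩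
    · rw [hai i]
      by_cases hi : i ∈ e.1
      · simp [hi, hone i hi]
      · simp [hi, hloop i hi, ha i e hi]
    · funext o
      have h1 := hai i
      split_ifs with hi
      · rcases o with _ | f
        · simp [h1, hone i hi]
        · by_cases hf : f = e
          · subst hf; simp [hone i hi]
          · simp [hother f hf, hf]
      · rcases o with _ | f
        · simp [hloop i hi]
        · by_cases hf : f = e
          · subst hf; simp [ha i f hi]
          · simp [hother f hf]

end

end HTensor

/-! ### The trace formula below order 2k -/

namespace HTensor

open MvPolynomial

section

theorem multinomial_single_none {O : Type*} [Fintype O] [DecidableEq O] (n : ℕ) :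
    Nat.multinomial Finset.univ (Pi.single none n : Option O → ℕ) = 1 := by
  have h := Nat.multinomial_spec Finset.univ (Pi.single none n : Option O → ℕ)
  simp only [Fintype.prod_option, Fintype.sum_option] at h
  simpa [Nat.factorial_ne_zero] using h

theorem multinomial_single_none_add {O : Type*} [Fintype O] [DecidableEq O] (n : ℕ) (o : O) :
    Nat.multinomial Finset.univ (Pi.single none n + Pi.single (some o) 1 : Option O → ℕ)
      = n + 1 := by
  have h := Nat.multinomial_spec Finset.univ (Pi.single none n + Pi.single (some o) 1 : Option O → ℕ)
  have h1 : ∏ x : O, ((Pi.single (some o) 1 : Option O → ℕ) (some x)).factorial = 1 :=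
    Finset.prod_eq_one fun x _ => by
      by_cases hx : x = o <;> simp [hx]
  have h2 : ∑ x : O, (Pi.single (some o) 1 : Option O → ℕ) (some x) = 1 := by
    simp [Pi.single_apply]
  simp only [Fintype.prod_option, Fintype.sum_option, Pi.add_apply, Pi.single_eq_same,
    Pi.single_eq_of_ne (Option.some_ne_none _), Pi.single_eq_of_ne (Option.some_ne_none _).symm,
    zero_add, add_zero, h1, h2, mul_one, Nat.factorial_succ] at h
  rw [mul_comm] at h
  exact Nat.eq_of_mul_eq_mul_right (Nat.factorial_pos n) h

theorem degree_completeArcs {ι : Type*} [DecidableEq ι] (S : Finset ι) (c : ι → ℕ) :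
    (completeArcs S c).degree = ∑ u ∈ S, (c u + (S.card - 1)) := by
  rw [completeArcs, map_sum]
  refine Finset.sum_congr rfl fun u hu => ?_
  rw [map_sum, ← Finset.add_sum_erase _ _ hu]
  congr 1
  · simp
  · rw [Finset.sum_congr rfl fun v hv => ?_, Finset.sum_const, Finset.card_erase_of_mem hu,
      smul_eq_mul, mul_one]
    rw [Finsupp.degree_single, if_neg (Finset.ne_of_mem_erase hv).symm]

variable {ι κ : Type*} [DecidableEq ι] [Fintype ι] [DecidableEq κ] [Fintype κ]
  {k : ℕ} {E : Finset (Finset ι)}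

/-- The weight with which a single edge on the support of `δ`, together with `δ v - 1` loop tuples
at each of its vertices `v`, contributes to a trace. -/
noncomputable def edgeWeight (k : ℕ) (δ : ι → ℕ) : ℝ :=
  (∏ i, ((Nat.factorial (δ i * (k - 1)) : ℝ)⁻¹)) * (∏ i, if δ i = 0 then 1 else (δ i : ℝ)) *
    apolar (powTrace ι ℝ ((∑ i, δ i) * (k - 1)))
      (monomial (completeArcs (Finset.univ.filter (δ · ≠ 0)) fun u => (δ u - 1) * (k - 1)) 1)

/-- The generic trace polynomial is symmetric under relabelling, so the weight depends only on the
multiplicities. This makes the edge contributions of different hypertrees comparable. -/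
theorem edgeWeight_reindex (σ : ι ≃ κ) (δ : κ → ℕ) :
    edgeWeight k (δ ∘ σ) = edgeWeight k δ := by
  rw [edgeWeight, edgeWeight, ← rename_powTrace σ, ← σ.sum_comp, ← σ.prod_comp, ← σ.prod_comp]
  have harcs : completeArcs (Finset.univ.filter (δ · ≠ 0)) (fun u => (δ u - 1) * (k - 1)) =
      Finsupp.mapDomain (Prod.map σ σ) (completeArcs (Finset.univ.filter ((δ ∘ σ) · ≠ 0))
        fun u => ((δ ∘ σ) u - 1) * (k - 1)) := by
    have hf : Finset.univ.filter (δ · ≠ 0) =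
        (Finset.univ.filter ((δ ∘ σ) · ≠ 0)).map σ.toEmbedding := by
      ext x; simp
    simp only [completeArcs, Finsupp.mapDomain_finsetSum, hf, Finset.sum_map,
      Finsupp.mapDomain_single]
    simp
  rw [harcs, ← rename_monomial, apolar_rename (σ.injective.prodMap σ.injective)]
  rfl

/-- The complete digraph on the support, with the prescribed loops, carries a closed walk. Its
length agrees with the power of the generic matrix because each u emits (δ u - 1)(k-1) loops and k -
1 further arcs. -/
theorem edgeWeight_pos (hk : 1 ≤ k) {δ : ι → ℕ} (hδ : (Finset.univ.filter (δ · ≠ 0)).card = k) :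
    0 < edgeWeight k δ := by
  obtain ⟨r, hr⟩ : (Finset.univ.filter (δ · ≠ 0)).Nonempty := by rw [← Finset.card_pos]; omega
  have h := (isWalk_completeArcs hr fun u => (δ u - 1) * (k - 1)).coeff_powTrace_pos
  rw [degree_completeArcs, hδ, Finset.sum_congr rfl (g := fun u => δ u * (k - 1)),
    ← Finset.sum_mul, Finset.sum_filter_ne_zero] at h
  · rw [edgeWeight, apolar_monomial, one_mul]
    refine mul_pos (mul_pos (Finset.prod_pos fun i _ => by positivity)
      (Finset.prod_pos fun i _ => ?_)) (mul_pos ?_ h)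
    · split_ifs with h0
      · simp
      · have := Nat.pos_of_ne_zero h0; positivity
    · exact Finset.prod_pos fun _ _ => by positivity
  · intro u hu
    obtain ⟨n, hn⟩ := Nat.exists_eq_succ_of_ne_zero (Finset.mem_filter.1 hu).2
    rw [hn, Nat.succ_sub_one, Nat.succ_mul]

/-- The contribution of a row multiplicity vector `δ` to a trace of an `edgeTensor`. -/
theorem apolar_edgeTensor (hk : 2 ≤ k) (hcut : HasCuts E) (hE : ∀ e ∈ E, e.card = k) (α : ℝ)
    {d : ℕ} (hd0 : d ≠ 0) (hd : d < 2 * k) {δ : ι → ℕ} (hδ : ∑ i, δ i = d) :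
    (∏ i, ((Nat.factorial (δ i * (k - 1)) : ℝ)⁻¹)) *
        apolar (powTrace ι ℝ (d * (k - 1))) (∏ i, rowPoly (edgeTensor k E α) i ^ δ i) =
      (∑ i, if δ = Pi.single i d then (α * edgeDegree E i) ^ d else 0) +
        ∑ e ∈ E, if Finset.univ.filter (δ · ≠ 0) = e then
          (1 - α) ^ k * (edgeWeight k δ * ∏ i ∈ e, (α * edgeDegree E i) ^ (δ i - 1)) else 0 := by
  have hδ0 : δ ≠ 0 := by rintro rfl; simp at hδ; omega
  simp_rw [rowPoly_edgeTensor hE]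
  rw [apolar_prod_pow]
  -- A nonzero term has a nonzero coefficient product, so no row uses an edge that avoids its
  -- vertex, and a nonzero walk coefficient. Hence the classification applies.
  have hclass (a : ι → Option E → ℕ)
      (ha : a ∈ Fintype.piFinset fun j => Finset.piAntidiag (Finset.univ : Finset (Option E)) (δ j))
      (hne : (∏ j, ((Nat.multinomial Finset.univ (a j) : ℝ) *
          ∏ o, optionCoeff E α j o ^ a j o)) * apolar (powTrace ι ℝ (d * (k - 1)))
            (monomial (choiceArcs k E a) 1) ≠ 0) :=
    choice_classification hk hcut hE hδ0 (hδ.trans_lt hd) (a := a) (N := d * (k - 1))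
      (fun i => (Finset.mem_piAntidiag.1 (Fintype.mem_piFinset.1 ha i)).1)
      (fun i e hi => by
        by_contra h
        refine (mul_ne_zero_iff.1 hne).1 (Finset.prod_eq_zero (Finset.mem_univ i) ?_)
        rw [Finset.prod_eq_zero (Finset.mem_univ (some e)), mul_zero]
        rw [optionCoeff, if_neg hi, zero_pow h])
      (fun h => by
        refine (mul_ne_zero_iff.1 hne).2 ?_
        rw [apolar_monomial, h, mul_zero, mul_zero])
  by_cases h1 : ∃ i, δ = Pi.single i d
  · obtain ⟨i, hi⟩ := h1
    have hδi : δ i = d := by simp [hi]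
    have hδj (j) (hj : j ≠ i) : δ j = 0 := by simp [hi, hj]
    have hmem : (fun j => Pi.single none (δ j) : ι → Option E → ℕ) ∈
        Fintype.piFinset fun j => Finset.piAntidiag (Finset.univ : Finset (Option E)) (δ j) := by
      simp [Fintype.mem_piFinset, Finset.mem_piAntidiag]
    rw [Finset.sum_eq_single (fun j => Pi.single none (δ j)) _ fun h => absurd hmem h]
    · have h2 : ∑ e ∈ E, (if Finset.univ.filter (δ · ≠ 0) = e then
          (1 - α) ^ k * (edgeWeight k δ * ∏ i ∈ e, (α * edgeDegree E i) ^ (δ i - 1)) else 0) = 0 := by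
        refine Finset.sum_eq_zero fun e he => if_neg fun h => ?_
        have h3 : Finset.univ.filter (δ · ≠ 0) ⊆ {i} := fun j hj => by
          by_contra hji
          exact (Finset.mem_filter.1 hj).2 (hδj j (by simpa using hji))
        have h4 := Finset.card_le_card h3
        rw [h, hE e he, Finset.card_singleton] at h4
        omega
      have h7 : (∑ i, if δ = Pi.single i d then (α * edgeDegree E i) ^ d else 0) =
          (α * edgeDegree E i) ^ d := by
        rw [Finset.sum_eq_single i, if_pos hi]
        · intro j _ hj
          rw [if_neg]
          intro h
          apply hd0
          have := hδj j hj
          rw [h] at this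
          simpa using this
        · simp
      rw [h2, add_zero, h7, Finset.prod_eq_single i, Finset.prod_eq_single i,
        multinomial_single_none, hδi, Finset.prod_eq_single none]
      · have h5 : ∑ j, ∑ o, (Pi.single none (δ j) : Option E → ℕ) o • optionArcs k E j o =
            Finsupp.single (i, i) (d * (k - 1)) := by
          rw [Finset.sum_eq_single i, Fintype.sum_option]
          · simp only [Pi.single_eq_same, optionArcs, Finsupp.smul_single, smul_eq_mul, hδi,
              Pi.single_eq_of_ne (Option.some_ne_none _), zero_smul, Finset.sum_const_zero, add_zero]
          · intro j _ hj
            simp [hδj j hj]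
          · simp
        have h6 : d * (k - 1) ≠ 0 := Nat.mul_ne_zero hd0 (by omega)
        -- The pairing contributes (d(k-1))!, which cancels the prefactor of row i.
        rw [h5, apolar_monomial, coeff_powTrace_loops i h6, Finsupp.prod_single_index (by simp)]
        have : (Nat.factorial (d * (k - 1)) : ℝ) ≠ 0 := by positivity
        simp only [optionCoeff, Pi.single_eq_same, hδi, Nat.cast_one, one_mul, mul_one]
        field_simp
      · intro o _ ho
        simp [ho]
      · simp
      · intro j _ hj
        have := multinomial_single_none (O := E) 0
        rw [Pi.single_zero] at this
        simp [hδj j hj, this]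
      · simp
      · intro j _ hj
        simp [hδj j hj]
      · simp
    · intro a ha hne
      by_contra hterm
      rcases hclass a ha hterm with ⟨j, -, h⟩ | ⟨e, h, -⟩
      · exact hne (funext h)
      · have h3 : e.1 ⊆ {i} := fun j hj => by
          by_contra hji
          exact (h j).2 hj (hδj j (by simpa using hji))
        have h4 := Finset.card_le_card h3
        rw [hE _ e.2, Finset.card_singleton] at h4
        omega
  · rw [Finset.sum_eq_zero (s := (Finset.univ : Finset ι)) fun i _ => if_neg fun h => h1 ⟨i, h⟩,
      zero_add]
    have hnosingle (i : ι) (hi : ∀ j, j ≠ i → δ j = 0) : False := by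
      refine h1 ⟨i, funext fun j => ?_⟩
      by_cases hj : j = i
      · subst hj
        rw [← hδ, Finset.sum_eq_single j (fun x _ hx => hi x hx) (by simp)]
        simp
      · simp [hi j hj, hj]
    by_cases h2 : Finset.univ.filter (δ · ≠ 0) ∈ E
    · rw [Finset.sum_ite_eq, if_pos h2]
      set e : E := ⟨_, h2⟩ with he
      have hsupp (i) : i ∈ e.1 ↔ δ i ≠ 0 := by simp [he]
      set a₀ : ι → Option E → ℕ := fun i =>
        if i ∈ e.1 then Pi.single none (δ i - 1) + Pi.single (some e) 1 else 0 with ha₀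
      have hmem : a₀ ∈ Fintype.piFinset fun j =>
          Finset.piAntidiag (Finset.univ : Finset (Option E)) (δ j) := by
        simp only [Fintype.mem_piFinset, Finset.mem_piAntidiag, Finset.mem_univ, implies_true,
          and_true]
        intro i
        by_cases hi : i ∈ e.1
        · simp only [ha₀, if_pos hi, Pi.add_apply, Finset.sum_add_distrib, Finset.sum_pi_single',
            Finset.mem_univ, if_true]
          exact Nat.sub_add_cancel (Nat.pos_of_ne_zero ((hsupp i).1 hi))
        · have := (hsupp i).not.1 hi
          simp only [ha₀, if_neg hi, Pi.zero_apply, Finset.sum_const_zero]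
          simpa using Eq.symm (not_not.1 this)
      rw [Finset.sum_eq_single a₀ _ fun h => absurd hmem h]
      · have harcs : ∑ j, ∑ o, a₀ j o • optionArcs k E j o =
            completeArcs (Finset.univ.filter (δ · ≠ 0)) fun u => (δ u - 1) * (k - 1) := by
          rw [completeArcs, ← Finset.sum_subset (Finset.subset_univ e.1)]
          · refine Finset.sum_congr rfl fun i hi => ?_
            have hi' : i ∈ e.1 := hi
            simp only [ha₀, if_pos hi', Pi.add_apply, add_smul, Finset.sum_add_distrib]
            rw [Finset.sum_eq_single none (by intro o _ ho; simp [ho]) (by simp),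
              Finset.sum_eq_single (some e) (by intro o _ ho; simp [ho]) (by simp),
              ← Finset.add_sum_erase _ _ hi]
            simp only [Pi.single_eq_same, optionArcs, Finsupp.smul_single, smul_eq_mul, one_smul,
              if_true]
            congr 1
            refine Finset.sum_congr rfl fun v hv => ?_
            rw [if_neg (Finset.ne_of_mem_erase hv).symm]
          · intro i _ hi
            simp [ha₀, if_neg hi]
        rw [harcs, edgeWeight, hδ]
        -- Each vertex i of the edge picks which of its δ i factors is the edge summand. This is the
        -- origin of the factor δ i in `edgeWeight`.
        have hcoef : ∏ j, ((Nat.multinomial Finset.univ (a₀ j) : ℝ) *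
            ∏ o, optionCoeff E α j o ^ a₀ j o) = (∏ i, if δ i = 0 then 1 else (δ i : ℝ)) *
              ((1 - α) ^ k * ∏ i ∈ e.1, (α * edgeDegree E i) ^ (δ i - 1)) := by
          have hpow : (1 - α) ^ k = ∏ i ∈ e.1, (1 - α) := by
            rw [Finset.prod_const, hE _ e.2]
          rw [hpow, ← Finset.prod_mul_distrib, Finset.prod_mul_distrib]
          congr 1
          · refine Finset.prod_congr rfl fun i _ => ?_
            by_cases hi : i ∈ e.1
            · rw [if_neg ((hsupp i).1 hi)]
              simp only [ha₀, if_pos hi]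
              rw [multinomial_single_none_add,
                Nat.sub_add_cancel (Nat.pos_of_ne_zero ((hsupp i).1 hi))]
            · rw [if_pos (not_not.1 ((hsupp i).not.1 hi))]
              simp only [ha₀, if_neg hi]
              have := multinomial_single_none (O := E) 0
              rw [Pi.single_zero] at this
              rw [this, Nat.cast_one]
          · rw [← Finset.prod_subset (Finset.subset_univ e.1)]
            · refine Finset.prod_congr rfl fun i hi => ?_
              simp only [ha₀, if_pos hi, Pi.add_apply, pow_add, Finset.prod_mul_distrib]
              rw [Finset.prod_eq_single none (by intro o _ ho; simp [ho]) (by simp),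
                Finset.prod_eq_single (some e) (by intro o _ ho; simp [ho])
                  (by simp)]
              simp only [Pi.single_eq_same, optionCoeff, if_pos hi, pow_one]
              ring
            · intro i _ hi
              simp [ha₀, if_neg hi]
        rw [hcoef]
        ring
      · intro a ha hne
        by_contra hterm
        rcases hclass a ha hterm with ⟨j, h, -⟩ | ⟨f, hf, haf⟩
        · exact hnosingle j h
        · have : f = e := Subtype.ext (Finset.ext fun i => by rw [hsupp, hf])
          subst this
          exact hne (funext haf)
    · rw [Finset.sum_ite_eq, if_neg h2, Finset.sum_eq_zero, mul_zero]
      intro a ha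
      by_contra hterm
      rcases hclass a ha hterm with ⟨j, h, -⟩ | ⟨f, hf, -⟩
      · exact hnosingle j h
      · refine h2 ?_
        have : Finset.univ.filter (δ · ≠ 0) = f.1 := by ext i; simp [hf]
        exact this ▸ f.2

/-- The traces of order below `2 * k` of the `𝓐_α`-tensor of a `k`-uniform hypertree. -/
theorem trace_edgeTensor (hk : 2 ≤ k) (hcut : HasCuts E) (hE : ∀ e ∈ E, e.card = k) (α : ℝ)
    {d : ℕ} (hd0 : d ≠ 0) (hd : d < 2 * k) :
    trace d (edgeTensor k E α) = ((k : ℝ) - 1) ^ (Fintype.card ι - 1) *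
      ((∑ i, (α * edgeDegree E i) ^ d) + (1 - α) ^ k * ∑ e ∈ E,
        ∑ δ ∈ (Finset.piAntidiag (Finset.univ : Finset ι) d) with Finset.univ.filter (δ · ≠ 0) = e,
          edgeWeight k δ * ∏ i ∈ e, (α * edgeDegree E i) ^ (δ i - 1)) := by
  rw [trace_eq_apolar, Finset.sum_congr rfl fun δ hδ => apolar_edgeTensor hk hcut hE α hd0 hd
    (Finset.mem_piAntidiag.1 hδ).1, Finset.sum_add_distrib, Finset.sum_comm]
  congr 2
  · refine Finset.sum_congr rfl fun i _ => ?_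
    rw [Finset.sum_ite_eq', if_pos]
    simp
  · rw [Finset.sum_comm, Finset.mul_sum]
    refine Finset.sum_congr rfl fun e _ => ?_
    rw [Finset.sum_filter, Finset.mul_sum]
    refine Finset.sum_congr rfl fun δ _ => ?_
    rw [mul_ite, mul_zero]

end

end HTensor

/-! ### Edge contributions in orders k, k + 1 and k + 2 -/

/-- Euler's identity: replace n + 1 by the sum of the l i, exchange the sums, and remove one unit at
i; terms with l i = 0 drop out. It lowers sums of degree one and two to sums over single vertices
and ordered pairs. -/
theorem Finset.succ_mul_sum_piAntidiag {ι R : Type*} [DecidableEq ι] [CommSemiring R] (e : Finset ι)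
    (n : ℕ) (h : (ι → ℕ) → R) :
    (n + 1) * ∑ l ∈ e.piAntidiag (n + 1), h l =
      ∑ i ∈ e, ∑ l ∈ e.piAntidiag n, (l i + 1) * h (l + Pi.single i 1) := by
  have h1 : ((n : R) + 1) * ∑ l ∈ e.piAntidiag (n + 1), h l =
      ∑ l ∈ e.piAntidiag (n + 1), ∑ i ∈ e, (l i : R) * h l := by
    rw [Finset.mul_sum]
    refine Finset.sum_congr rfl fun l hl => ?_
    rw [← Finset.sum_mul, ← Nat.cast_sum, (Finset.mem_piAntidiag.1 hl).1]
    push_cast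
    rfl
  rw [h1, Finset.sum_comm]
  refine Finset.sum_congr rfl fun i hi => ?_
  rw [← Finset.sum_filter_of_ne (p := fun l => l i ≠ 0) fun l _ hl h0 => hl (by simp [h0])]
  refine Finset.sum_nbij' (fun l => l - Pi.single i 1) (fun l => l + Pi.single i 1) ?_ ?_ ?_ ?_ ?_
  · intro l hl
    obtain ⟨hl, hli⟩ := Finset.mem_filter.1 hl
    rw [Finset.mem_piAntidiag] at hl ⊢
    refine ⟨?_, fun j hj => hl.2 j fun h0 => hj (by simp [h0])⟩
    have h2 : e.sum (l - Pi.single i 1 + Pi.single i 1 : ι → ℕ) = n + 1 := by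
      rw [tsub_add_cancel_of_le, hl.1]
      intro j
      by_cases hj : j = i
      · subst hj; simpa using Nat.one_le_iff_ne_zero.2 hli
      · simp [hj]
    rw [Finset.sum_congr rfl fun j _ => Pi.add_apply _ _ j, Finset.sum_add_distrib,
      Finset.sum_pi_single', if_pos hi] at h2
    exact Nat.add_right_cancel h2
  · intro l hl
    rw [Finset.mem_piAntidiag] at hl
    rw [Finset.mem_filter, Finset.mem_piAntidiag]
    refine ⟨⟨?_, fun j hj => ?_⟩, by simp⟩
    · rw [Finset.sum_congr rfl fun j _ => Pi.add_apply _ _ j, Finset.sum_add_distrib,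
        Finset.sum_pi_single', if_pos hi, hl.1]
    · by_cases hji : j = i
      · exact hji ▸ hi
      · exact hl.2 j fun h0 => hj (by simp [h0, hji])
  · intro l hl
    refine tsub_add_cancel_of_le fun j => ?_
    by_cases hj : j = i
    · subst hj; simpa using Nat.one_le_iff_ne_zero.2 (Finset.mem_filter.1 hl).2
    · simp [hj]
  · intro l _
    exact add_tsub_cancel_right _ _
  · intro l hl
    have hle : (Pi.single i 1 : ι → ℕ) ≤ l := fun j => by
      by_cases hj : j = i
      · subst hj; simpa using Nat.one_le_iff_ne_zero.2 (Finset.mem_filter.1 hl).2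
      · simp [hj]
    rw [tsub_add_cancel_of_le hle]
    congr 1
    have := hle i
    simp only [Pi.single_eq_same] at this
    rw [Pi.sub_apply, Pi.single_eq_same]
    exact (congrArg (Nat.cast : ℕ → R) (Nat.sub_add_cancel this).symm).trans (Nat.cast_succ _)

/-- Match the sets and their complements by cardinality, then correct inside f by a permutation,
since the symmetric group is 2-transitive. -/
theorem exists_equiv_finset {ι κ : Type*} [DecidableEq ι] [Fintype ι] [DecidableEq κ] [Fintype κ]
    (hcard : Fintype.card ι = Fintype.card κ) {e : Finset ι} {f : Finset κ} (hef : e.card = f.card)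
    {i j : ι} {i' j' : κ} (hi : i ∈ e) (hj : j ∈ e) (hij : i ≠ j) (hi' : i' ∈ f) (hj' : j' ∈ f)
    (hij' : i' ≠ j') : ∃ σ : ι ≃ κ, (∀ v, σ v ∈ f ↔ v ∈ e) ∧ σ i = i' ∧ σ j = j' := by
  have τ : {v // v ∈ e} ≃ {v // v ∈ f} := Fintype.equivOfCardEq (by simpa using hef)
  have ρ : {v // ¬ v ∈ e} ≃ {v // ¬ v ∈ f} := Fintype.equivOfCardEq (by
    rw [Fintype.card_subtype_compl, Fintype.card_subtype_compl, hcard]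
    simp [hef])
  have h2 : MulAction.IsMultiplyPretransitive (Equiv.Perm {v // v ∈ f}) {v // v ∈ f} 2 :=
    Equiv.Perm.isMultiplyPretransitive _ 2
  rw [MulAction.is_two_pretransitive_iff] at h2
  obtain ⟨g, hg1, hg2⟩ := @h2 (τ ⟨i, hi⟩) (τ ⟨j, hj⟩) ⟨i', hi'⟩ ⟨j', hj'⟩
    (by simpa using hij) (by simpa using hij')
  let σ : ι ≃ κ := (Equiv.sumCompl (· ∈ e)).symm.trans
    ((Equiv.sumCongr (τ.trans g) ρ).trans (Equiv.sumCompl (· ∈ f)))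
  have hσ (v : ι) (hv : v ∈ e) : σ v = g (τ ⟨v, hv⟩) := by
    simp [σ, Equiv.sumCompl_symm_apply_of_pos hv]
  have hσ' (v : ι) (hv : v ∉ e) : σ v = ρ ⟨v, hv⟩ := by
    simp [σ, Equiv.sumCompl_symm_apply_of_neg hv]
  refine ⟨σ, fun v => ?_, ?_, ?_⟩
  · by_cases hv : v ∈ e
    · rw [hσ v hv]; exact iff_of_true (g (τ ⟨v, hv⟩)).2 hv
    · rw [hσ' v hv]; exact iff_of_false (ρ ⟨v, hv⟩).2 hv
  · rw [hσ i hi]; exact congrArg Subtype.val hg1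
  · rw [hσ j hj]; exact congrArg Subtype.val hg2

namespace HTensor

section

/-- The `edgeWeight` of a `k`-set in an `n`-set with `a` and `b` loop tuples at two of its vertices. -/
noncomputable def loopWeight (n k a b : ℕ) : ℝ :=
  edgeWeight k fun v : Fin n => (if v.1 < k then 1 else 0) + (if v.1 = 0 then a else 0) +
    if v.1 = 1 then b else 0

variable {ι : Type*} [DecidableEq ι] [Fintype ι] {k : ℕ}

theorem edgeWeight_eq_loopWeight {e : Finset ι} (he : e.card = k) {i j : ι} (hi : i ∈ e) (hj : j ∈ e)
    (hij : i ≠ j) (a b : ℕ) :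
    edgeWeight k (fun v => (if v ∈ e then 1 else 0) + (if v = i then a else 0) +
      if v = j then b else 0) = loopWeight (Fintype.card ι) k a b := by
  have h2 : 1 < e.card := Finset.one_lt_card.2 ⟨i, hi, j, hj, hij⟩
  have hle : e.card ≤ Fintype.card ι := Finset.card_le_univ e
  obtain ⟨σ, hσ, hσi, hσj⟩ := exists_equiv_finset (κ := Fin (Fintype.card ι)) (by simp)
    (f := Finset.univ.filter fun v => v.1 < k) (by
      rw [Fin.card_filter_val_lt, he, min_eq_right (by omega)]) hi hj hij
    (i' := ⟨0, by omega⟩) (j' := ⟨1, by omega⟩) (by simp; omega) (by simp; omega) (by simp)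
  rw [loopWeight, ← edgeWeight_reindex σ]
  congr 1
  funext v
  have h1 : (σ v).1 = 0 ↔ v = i := by rw [← σ.injective.eq_iff (a := v), hσi, Fin.ext_iff]
  have h3 : (σ v).1 = 1 ↔ v = j := by rw [← σ.injective.eq_iff (a := v), hσj, Fin.ext_iff]
  have h4 : (σ v).1 < k ↔ v ∈ e := by rw [← hσ v]; simp
  simp only [Function.comp_apply, h1, h3, h4]

theorem loopWeight_pos {n : ℕ} (hk : 2 ≤ k) (hn : k ≤ n) (a b : ℕ) : 0 < loopWeight n k a b := by
  refine edgeWeight_pos (by omega) ?_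
  refine Eq.trans ?_ ((Fin.card_filter_val_lt (n := n) (m := k)).trans (min_eq_right hn))
  congr 1
  ext v
  simp only [Finset.mem_filter, Finset.mem_univ, true_and]
  constructor
  · intro h
    by_contra hv
    rw [if_neg hv, if_neg (by omega), if_neg (by omega)] at h
    exact h rfl
  · intro h
    rw [if_pos h]
    omega

/-- The contribution of an edge `e` to a trace, if its vertices have the weights `w`. -/
noncomputable def edgeSum (k d : ℕ) (e : Finset ι) (w : ι → ℝ) : ℝ :=
  ∑ δ ∈ (Finset.piAntidiag (Finset.univ : Finset ι) d) with Finset.univ.filter (δ · ≠ 0) = e,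
    edgeWeight k δ * ∏ i ∈ e, w i ^ (δ i - 1)

theorem edgeSum_of_lt {d : ℕ} {e : Finset ι} (he : e.card = k) (hd : d < k) (w : ι → ℝ) :
    edgeSum k d e w = 0 := by
  refine Finset.sum_eq_zero fun δ hδ => ?_
  obtain ⟨hδ, hs⟩ := Finset.mem_filter.1 hδ
  have h1 : e.card • 1 ≤ ∑ i ∈ e, δ i := Finset.card_nsmul_le_sum _ _ _ fun i hi => by
    rw [← hs] at hi
    exact Nat.one_le_iff_ne_zero.2 (Finset.mem_filter.1 hi).2
  have h2 : ∑ i ∈ e, δ i ≤ ∑ i, δ i := Finset.sum_le_sum_of_subset (Finset.subset_univ _)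
  rw [(Finset.mem_piAntidiag.1 hδ).1] at h2
  simp only [smul_eq_mul, mul_one] at h1
  omega

/-- Every vertex of e occurs at least once in δ; removing this obligatory unit leaves n loop tuples
to be distributed over e. -/
theorem edgeSum_add (n : ℕ) {e : Finset ι} (he : e.card = k) (w : ι → ℝ) :
    edgeSum k (k + n) e w = ∑ l ∈ e.piAntidiag n,
      edgeWeight k (fun v => (if v ∈ e then 1 else 0) + l v) * ∏ i ∈ e, w i ^ l i := by
  refine Finset.sum_nbij' (fun δ v => δ v - if v ∈ e then 1 else 0)
    (fun l v => (if v ∈ e then 1 else 0) + l v) ?_ ?_ ?_ ?_ ?_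
  · intro δ hδ
    obtain ⟨hδ, hs⟩ := Finset.mem_filter.1 hδ
    have hs' (v) : v ∈ e ↔ δ v ≠ 0 := by rw [← hs]; simp
    rw [Finset.mem_piAntidiag] at hδ ⊢
    refine ⟨?_, fun v hv => by_contra fun h => hv (by
      have := (hs' v).not.1 h
      simp [not_not.1 this])⟩
    have h1 : ∑ v ∈ e, δ v = k + n := by
      rw [← hδ.1]
      exact Finset.sum_subset (Finset.subset_univ _) fun v _ hv => not_not.1 ((hs' v).not.1 hv)
    have h2 : ∑ v ∈ e, δ v = ∑ v ∈ e, ((δ v - if v ∈ e then 1 else 0) + 1) :=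
      Finset.sum_congr rfl fun v hv => by
        rw [if_pos hv, Nat.sub_add_cancel (Nat.one_le_iff_ne_zero.2 ((hs' v).1 hv))]
    rw [Finset.sum_add_distrib, ← Finset.card_eq_sum_ones, he] at h2
    omega
  · intro l hl
    rw [Finset.mem_piAntidiag] at hl
    rw [Finset.mem_filter, Finset.mem_piAntidiag]
    refine ⟨⟨?_, by simp⟩, ?_⟩
    · rw [Finset.sum_add_distrib, ← Finset.sum_filter, ← Finset.card_eq_sum_ones,
        ← Finset.sum_subset (Finset.subset_univ e) fun v _ hv => by_contra fun h => hv (hl.2 v h),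
        hl.1]
      simp [he]
    · ext v
      by_cases hv : v ∈ e
      · simp [hv]
      · simp [hv]
        exact by_contra fun h => hv (hl.2 v h)
  · intro δ hδ
    obtain ⟨hδ, hs⟩ := Finset.mem_filter.1 hδ
    have hs' (v) : v ∈ e ↔ δ v ≠ 0 := by rw [← hs]; simp
    funext v
    by_cases hv : v ∈ e
    · simp only [if_pos hv]
      have := (hs' v).1 hv
      omega
    · simp [hv]
  · intro l _
    funext v
    exact Nat.add_sub_cancel_left (n := if v ∈ e then 1 else 0) (m := l v)
  · intro δ hδ
    obtain ⟨hδ, hs⟩ := Finset.mem_filter.1 hδ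
    have hs' (v) : v ∈ e ↔ δ v ≠ 0 := by rw [← hs]; simp
    congr 1
    · congr 1
      funext v
      by_cases hv : v ∈ e
      · simp only [if_pos hv]
        have := (hs' v).1 hv
        omega
      · simp [hv]
    · exact Finset.prod_congr rfl fun v hv => by simp only [if_pos hv]

variable {e : Finset ι}

theorem edgeSum_zero (hk : 2 ≤ k) (he : e.card = k) (w : ι → ℝ) :
    edgeSum k k e w = loopWeight (Fintype.card ι) k 0 0 := by
  obtain ⟨i, hi, j, hj, hij⟩ := Finset.one_lt_card.1 (by omega : 1 < e.card)
  have := edgeSum_add 0 he w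
  rw [add_zero] at this
  rw [this, ← edgeWeight_eq_loopWeight he hi hj hij]
  simp

theorem edgeSum_one (hk : 2 ≤ k) (he : e.card = k) (w : ι → ℝ) :
    edgeSum k (k + 1) e w = loopWeight (Fintype.card ι) k 1 0 * ∑ i ∈ e, w i := by
  have := Finset.succ_mul_sum_piAntidiag e 0
    (fun l => edgeWeight k (fun v => (if v ∈ e then 1 else 0) + l v) * ∏ i ∈ e, w i ^ l i)
  rw [Nat.cast_zero, zero_add, one_mul, zero_add, ← edgeSum_add 1 he w] at this
  rw [this, Finset.mul_sum]
  refine Finset.sum_congr rfl fun i hi => ?_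
  obtain ⟨j, hj, hij⟩ := Finset.exists_mem_ne (by omega : 1 < e.card) i
  rw [← edgeWeight_eq_loopWeight he hi hj hij.symm]
  simp only [Finset.piAntidiag_zero, Finset.sum_singleton, Pi.zero_apply, Nat.cast_zero, zero_add,
    one_mul]
  congr 1
  · simp [Pi.single_apply]
  · rw [Finset.prod_eq_single i]
    · simp
    · intro v _ hv; simp [hv]
    · exact fun h => absurd hi h

/-- With W20 and W11 the weights of two loop tuples at one vertex or at two different ones, the sum
is W20 ∑ w_i² plus W11 times the sum of w_i w_j over unordered pairs. Completing the square isolates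
(∑ w_i)², whose coefficient W11/2 is positive and decides the final comparison. -/
theorem edgeSum_two (hk : 2 ≤ k) (he : e.card = k) (w : ι → ℝ) :
    edgeSum k (k + 2) e w = (loopWeight (Fintype.card ι) k 2 0 -
      loopWeight (Fintype.card ι) k 1 1 / 2) * ∑ i ∈ e, w i ^ 2 +
        loopWeight (Fintype.card ι) k 1 1 / 2 * (∑ i ∈ e, w i) ^ 2 := by
  set H : (ι → ℕ) → ℝ := fun l =>
    edgeWeight k (fun v => (if v ∈ e then 1 else 0) + l v) * ∏ i ∈ e, w i ^ l i with hH
  have h2 := Finset.succ_mul_sum_piAntidiag e 1 H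
  have h1 (i : ι) := Finset.succ_mul_sum_piAntidiag e 0
    fun l => ((l i : ℝ) + 1) * H (l + Pi.single i 1)
  simp only [Nat.cast_zero, zero_add, one_mul, Finset.piAntidiag_zero, Finset.sum_singleton,
    Pi.zero_apply] at h1
  simp only [h1] at h2
  have hS := edgeSum_add 2 he w
  -- Terms of twice the sum, over ordered pairs: 2 W20 w_i² on the diagonal, W11 w_i w_j off it.
  have hterm (i) (hi : i ∈ e) (j) (hj : j ∈ e) :
      (((Pi.single j 1 : ι → ℕ) i : ℝ) + 1) * H (Pi.single j 1 + Pi.single i 1) =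
        (if i = j then 2 * loopWeight (Fintype.card ι) k 2 0 - loopWeight (Fintype.card ι) k 1 1
          else 0) * w i ^ 2 + loopWeight (Fintype.card ι) k 1 1 * (w i * w j) := by
    have hprod : ∏ v ∈ e, w v ^ (Pi.single j 1 + Pi.single i 1 : ι → ℕ) v = w i * w j := by
      simp only [Pi.add_apply, pow_add, Finset.prod_mul_distrib]
      rw [Finset.prod_eq_single j (fun v _ hv => by simp [hv]) (fun h => absurd hj h),
        Finset.prod_eq_single i (fun v _ hv => by simp [hv]) (fun h => absurd hi h)]
      simp [mul_comm]
    simp only [hH, hprod]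
    by_cases hij : i = j
    · subst hij
      obtain ⟨j, hj, hij⟩ := Finset.exists_mem_ne (by omega : 1 < e.card) i
      have : edgeWeight k (fun v => (if v ∈ e then 1 else 0) +
          (Pi.single i 1 + Pi.single i 1 : ι → ℕ) v) = loopWeight (Fintype.card ι) k 2 0 := by
        rw [← edgeWeight_eq_loopWeight he hi hj hij.symm]
        congr 1
        funext v
        by_cases hv : v = i <;> simp [hv]
      rw [this, if_pos rfl, Pi.single_eq_same]
      push_cast
      ring
    · have : edgeWeight k (fun v => (if v ∈ e then 1 else 0) +
          (Pi.single j 1 + Pi.single i 1 : ι → ℕ) v) = loopWeight (Fintype.card ι) k 1 1 := by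
        rw [← edgeWeight_eq_loopWeight he hi hj hij]
        congr 1
        funext v
        simp only [Pi.add_apply, Pi.single_apply]
        ring
      rw [this, if_neg hij, Pi.single_eq_of_ne hij]
      push_cast
      ring
  rw [Finset.sum_congr rfl fun i hi => Finset.sum_congr rfl fun j hj => hterm i hi j hj] at h2
  simp only [Finset.sum_add_distrib, ite_mul, zero_mul, Finset.sum_ite_eq, ← Finset.mul_sum,
    ← Finset.sum_mul] at h2
  rw [Finset.sum_congr rfl (g := fun i => (2 * loopWeight (Fintype.card ι) k 2 0 -
    loopWeight (Fintype.card ι) k 1 1) * w i ^ 2) (fun i hi => if_pos hi), ← Finset.mul_sum] at h2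
  rw [hS]
  push_cast at h2
  linarith

end

end HTensor

/-! ### Traces of low order and their comparison -/

namespace HTensor

open MvPolynomial

section

theorem trace_zero {k : ℕ} {ι R : Type*} [Field R] [Fintype ι] (A : HTensor k ι R) :
    trace 0 A = ((k : R) - 1) ^ (Fintype.card ι - 1) * Fintype.card ι := by
  classical
  rw [trace_eq_apolar, Finset.piAntidiag_zero, Finset.sum_singleton]
  simp only [Pi.zero_apply, zero_mul, Nat.factorial_zero, Nat.cast_one, inv_one, pow_zero,
    Finset.prod_const_one, one_mul, apolar_one, constantCoeff_eq]
  rw [coeff_powTrace]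
  simp

variable {ι : Type*} [DecidableEq ι] [Fintype ι] {k : ℕ} {E : Finset (Finset ι)}

theorem sum_edges_sum {R : Type*} [CommSemiring R] (E : Finset (Finset ι)) (g : ι → R) :
    ∑ e ∈ E, ∑ i ∈ e, g i = ∑ i, edgeDegree E i * g i := by
  have h (e : Finset ι) : ∑ i ∈ e, g i = ∑ i, if i ∈ e then g i else 0 := by simp
  simp_rw [h]
  rw [Finset.sum_comm]
  refine Finset.sum_congr rfl fun i _ => ?_
  rw [← Finset.sum_filter, Finset.sum_const, nsmul_eq_mul, edgeDegree]

theorem sum_edgeDegree (hE : ∀ e ∈ E, e.card = k) : ∑ i, edgeDegree E i = k * E.card := by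
  have h := sum_edges_sum E fun _ => (1 : ℕ)
  simp only [Finset.sum_const, smul_eq_mul, mul_one, Nat.cast_id] at h
  rw [← h, Finset.sum_congr rfl hE, Finset.sum_const, smul_eq_mul, mul_comm]

/-- On {1, 2} every function g agrees with an affine one, so the sum depends only on n and on the
total degree km. -/
theorem sum_edgeDegree_eq_of_mem (hE : ∀ e ∈ E, e.card = k)
    (hdeg : ∀ i, edgeDegree E i = 1 ∨ edgeDegree E i = 2) (g : ℕ → ℝ) :
    ∑ i, g (edgeDegree E i) =
      g 1 * Fintype.card ι + (g 2 - g 1) * (k * E.card - Fintype.card ι) := by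
  have h : ∀ i, g (edgeDegree E i) = g 1 + (g 2 - g 1) * ((edgeDegree E i : ℝ) - 1) := fun i => by
    rcases hdeg i with h | h <;> rw [h] <;> push_cast <;> ring
  rw [Finset.sum_congr rfl fun i _ => h i, Finset.sum_add_distrib, ← Finset.mul_sum,
    Finset.sum_sub_distrib, ← Nat.cast_sum, sum_edgeDegree hE]
  simp
  ring

/-- Double counting turns the sum of the s_e into ∑ d_v², so expanding the product leaves ∑ s_e² as
the only term not determined by the degrees, the number of edges, a and b. -/
theorem sum_edges_mul_eq (E : Finset (Finset ι)) (a b : ℝ) :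
    ∑ e ∈ E, ((∑ i ∈ e, (edgeDegree E i : ℝ)) - a) * ((∑ i ∈ e, (edgeDegree E i : ℝ)) - b) =
      ∑ e ∈ E, (∑ i ∈ e, (edgeDegree E i : ℝ)) ^ 2 -
        (a + b) * (∑ i, (edgeDegree E i : ℝ) ^ 2) + E.card * (a * b) := by
  have h : ∑ i, (edgeDegree E i : ℝ) ^ 2 = ∑ e ∈ E, ∑ i ∈ e, (edgeDegree E i : ℝ) := by
    rw [sum_edges_sum]
    exact Finset.sum_congr rfl fun i _ => sq _
  rw [h, ← nsmul_eq_mul, ← Finset.sum_const, Finset.mul_sum, ← Finset.sum_sub_distrib,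
    ← Finset.sum_add_distrib]
  exact Finset.sum_congr rfl fun e _ => by ring

theorem trace_edgeTensor_eq (hk : 2 ≤ k) (hcut : HasCuts E) (hE : ∀ e ∈ E, e.card = k) (α : ℝ)
    {d : ℕ} (hd0 : d ≠ 0) (hd : d < 2 * k) :
    trace d (edgeTensor k E α) = ((k : ℝ) - 1) ^ (Fintype.card ι - 1) *
      (α ^ d * (∑ i, (edgeDegree E i : ℝ) ^ d) + (1 - α) ^ k * ∑ e ∈ E,
        edgeSum k d e fun i => α * edgeDegree E i) := by
  rw [trace_edgeTensor hk hcut hE α hd0 hd, Finset.mul_sum _ _ (α ^ d)]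
  simp only [edgeSum, mul_pow _ _ d]

theorem trace_edgeTensor_of_lt (hk : 2 ≤ k) (hcut : HasCuts E) (hE : ∀ e ∈ E, e.card = k) (α : ℝ)
    {d : ℕ} (hd0 : d ≠ 0) (hd : d < k) :
    trace d (edgeTensor k E α) = ((k : ℝ) - 1) ^ (Fintype.card ι - 1) *
      (α ^ d * ∑ i, (edgeDegree E i : ℝ) ^ d) := by
  rw [trace_edgeTensor_eq hk hcut hE α hd0 (by omega),
    Finset.sum_eq_zero fun e he => edgeSum_of_lt (hE e he) hd _, mul_zero, add_zero]

theorem trace_edgeTensor_self (hk : 2 ≤ k) (hcut : HasCuts E) (hE : ∀ e ∈ E, e.card = k) (α : ℝ) :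
    trace k (edgeTensor k E α) = ((k : ℝ) - 1) ^ (Fintype.card ι - 1) *
      (α ^ k * (∑ i, (edgeDegree E i : ℝ) ^ k) +
        (1 - α) ^ k * (E.card * loopWeight (Fintype.card ι) k 0 0)) := by
  rw [trace_edgeTensor_eq hk hcut hE α (by omega) (by omega),
    Finset.sum_congr rfl fun e he => edgeSum_zero hk (hE e he) _, Finset.sum_const, nsmul_eq_mul]

theorem trace_edgeTensor_add_one (hk : 2 ≤ k) (hcut : HasCuts E) (hE : ∀ e ∈ E, e.card = k)
    (α : ℝ) :
    trace (k + 1) (edgeTensor k E α) = ((k : ℝ) - 1) ^ (Fintype.card ι - 1) *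
      (α ^ (k + 1) * (∑ i, (edgeDegree E i : ℝ) ^ (k + 1)) +
        (1 - α) ^ k * (loopWeight (Fintype.card ι) k 1 0 * α *
          ∑ i, (edgeDegree E i : ℝ) ^ 2)) := by
  rw [trace_edgeTensor_eq hk hcut hE α (by omega) (by omega),
    Finset.sum_congr rfl fun e he => edgeSum_one hk (hE e he) _, ← Finset.mul_sum, sum_edges_sum]
  congr 3
  rw [mul_assoc, Finset.mul_sum _ _ α]
  congr 1
  exact Finset.sum_congr rfl fun i _ => by ring

theorem trace_edgeTensor_add_two (hk : 3 ≤ k) (hcut : HasCuts E) (hE : ∀ e ∈ E, e.card = k)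
    (α : ℝ) :
    trace (k + 2) (edgeTensor k E α) = ((k : ℝ) - 1) ^ (Fintype.card ι - 1) *
      (α ^ (k + 2) * (∑ i, (edgeDegree E i : ℝ) ^ (k + 2)) +
        (1 - α) ^ k * α ^ 2 * ((loopWeight (Fintype.card ι) k 2 0 -
          loopWeight (Fintype.card ι) k 1 1 / 2) * ∑ i, (edgeDegree E i : ℝ) ^ 3 +
            loopWeight (Fintype.card ι) k 1 1 / 2 *
              ∑ e ∈ E, (∑ i ∈ e, (edgeDegree E i : ℝ)) ^ 2)) := by
  rw [trace_edgeTensor_eq (by omega) hcut hE α (by omega) (by omega),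
    Finset.sum_congr rfl fun e he => edgeSum_two (by omega) (hE e he) _, Finset.sum_add_distrib,
    ← Finset.mul_sum, sum_edges_sum]
  have h1 : ∑ i, (edgeDegree E i : ℝ) * (α * edgeDegree E i) ^ 2 =
      α ^ 2 * ∑ i, (edgeDegree E i : ℝ) ^ 3 := by
    rw [Finset.mul_sum]
    exact Finset.sum_congr rfl fun i _ => by ring
  have h2 (c : ℝ) : ∑ e ∈ E, c * (∑ i ∈ e, α * (edgeDegree E i : ℝ)) ^ 2 =
      c * α ^ 2 * ∑ e ∈ E, (∑ i ∈ e, (edgeDegree E i : ℝ)) ^ 2 := by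
    rw [Finset.mul_sum]
    exact Finset.sum_congr rfl fun e _ => by rw [← Finset.mul_sum]; ring
  rw [h1, h2]
  ring

variable {κ : Type*} [DecidableEq κ] [Fintype κ] {F : Finset (Finset κ)}

theorem trace_edgeTensor_one_eq (hk : 2 ≤ k) (hcard : Fintype.card ι = Fintype.card κ)
    (hEF : E.card = F.card) (hcut : HasCuts E) (hE : ∀ e ∈ E, e.card = k) (hcut' : HasCuts F)
    (hF : ∀ f ∈ F, f.card = k) (α : ℝ) :
    trace 1 (edgeTensor k E α) = trace 1 (edgeTensor k F α) := by
  rw [trace_edgeTensor_of_lt hk hcut hE α (by omega) (by omega),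
    trace_edgeTensor_of_lt hk hcut' hF α (by omega) (by omega)]
  simp only [pow_one, ← Nat.cast_sum, sum_edgeDegree hE, sum_edgeDegree hF, hcard, hEF]

/-- If all degrees are `1` or `2` for `F`, but not for `E`, the traces of order `2` differ. -/
theorem trace_edgeTensor_two_lt (hk : 3 ≤ k) (hcard : Fintype.card ι = Fintype.card κ)
    (hEF : E.card = F.card) (hcut : HasCuts E) (hE : ∀ e ∈ E, e.card = k) (hcut' : HasCuts F)
    (hF : ∀ f ∈ F, f.card = k) {α : ℝ} (hα : 0 < α) (hdeg : ∀ i, 1 ≤ edgeDegree E i)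
    (hdeg' : ∀ i, edgeDegree F i = 1 ∨ edgeDegree F i = 2) {i : ι} (hi : 2 < edgeDegree E i) :
    trace 2 (edgeTensor k F α) < trace 2 (edgeTensor k E α) := by
  rw [trace_edgeTensor_of_lt (by omega) hcut hE α (by omega) (by omega),
    trace_edgeTensor_of_lt (by omega) hcut' hF α (by omega) (by omega), hcard]
  have hk1 : (0 : ℝ) < (k : ℝ) - 1 := by
    have : (3 : ℝ) ≤ k := by exact_mod_cast hk
    linarith
  refine mul_lt_mul_of_pos_left (mul_lt_mul_of_pos_left ?_ (by positivity)) (by positivity)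
  -- Each term is nonnegative since the degrees are positive integers, and vanishes exactly at 1 and
  -- 2.
  have h1 : 0 < ∑ i, ((edgeDegree E i : ℝ) - 1) * ((edgeDegree E i : ℝ) - 2) := by
    refine Finset.sum_pos' (fun j _ => ?_) ⟨i, Finset.mem_univ _, ?_⟩
    · rcases (hdeg j).eq_or_lt with h | h
      · rw [← h]; simp
      · have : (2 : ℝ) ≤ edgeDegree E j := by exact_mod_cast h
        exact mul_nonneg (by linarith) (by linarith)
    · have : (2 : ℝ) < edgeDegree E i := by exact_mod_cast hi
      exact mul_pos (by linarith) (by linarith)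
  have h2 : ∑ i, ((edgeDegree E i : ℝ) - 1) * ((edgeDegree E i : ℝ) - 2) =
      (∑ i, (edgeDegree E i : ℝ) ^ 2) - 3 * (k * E.card : ℕ) + 2 * Fintype.card ι := by
    rw [← sum_edgeDegree hE, Nat.cast_sum, Finset.mul_sum, ← Finset.sum_sub_distrib, mul_comm (2 : ℝ),
      ← nsmul_eq_mul, ← Finset.card_univ, ← Finset.sum_const, ← Finset.sum_add_distrib]
    exact Finset.sum_congr rfl fun i _ => by ring
  rw [sum_edgeDegree_eq_of_mem hF hdeg' fun d => (d : ℝ) ^ 2]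
  rw [h2, hEF, hcard] at h1
  push_cast at h1 ⊢
  linarith

/-- Through order k + 1 only n, k, the number of edges and power sums of the degrees enter, and
these agree by the affine argument. -/
theorem trace_edgeTensor_eq_of_degree (hk : 3 ≤ k) (hcard : Fintype.card ι = Fintype.card κ)
    (hEF : E.card = F.card) (hcut : HasCuts E) (hE : ∀ e ∈ E, e.card = k) (hcut' : HasCuts F)
    (hF : ∀ f ∈ F, f.card = k) (α : ℝ) (hdeg : ∀ i, edgeDegree E i = 1 ∨ edgeDegree E i = 2)
    (hdeg' : ∀ i, edgeDegree F i = 1 ∨ edgeDegree F i = 2) {t : ℕ} (ht : t < k + 2) :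
    trace t (edgeTensor k F α) = trace t (edgeTensor k E α) := by
  have hsum (p : ℕ) : ∑ i, (edgeDegree E i : ℝ) ^ p = ∑ i, (edgeDegree F i : ℝ) ^ p := by
    rw [sum_edgeDegree_eq_of_mem hE hdeg fun d => (d : ℝ) ^ p,
      sum_edgeDegree_eq_of_mem hF hdeg' fun d => (d : ℝ) ^ p, hcard, hEF]
  have h2 : 2 ≤ k := by omega
  rcases Nat.eq_zero_or_pos t with rfl | h0
  · rw [trace_zero, trace_zero, hcard]
  rcases lt_trichotomy t k with h | rfl | h
  · rw [trace_edgeTensor_of_lt h2 hcut hE α (by omega) h,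
      trace_edgeTensor_of_lt h2 hcut' hF α (by omega) h, hcard, hsum]
  · rw [trace_edgeTensor_self h2 hcut hE, trace_edgeTensor_self h2 hcut' hF, hcard, hsum, hEF]
  · obtain rfl : t = k + 1 := by omega
    rw [trace_edgeTensor_add_one h2 hcut hE, trace_edgeTensor_add_one h2 hcut' hF, hcard, hsum, hsum]

/-- If all degrees are `1` or `2`, and the degree sum of an edge is always `k + 1` or `k + 2` for `F`,
but not for `E`, the traces of order `k + 2` differ. -/
theorem trace_edgeTensor_add_two_lt (hk : 3 ≤ k) (hcard : Fintype.card ι = Fintype.card κ)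
    (hEF : E.card = F.card) (hcut : HasCuts E) (hE : ∀ e ∈ E, e.card = k) (hcut' : HasCuts F)
    (hF : ∀ f ∈ F, f.card = k) {α : ℝ} (hα : 0 < α) (hα1 : α < 1)
    (hdeg : ∀ i, edgeDegree E i = 1 ∨ edgeDegree E i = 2)
    (hdeg' : ∀ i, edgeDegree F i = 1 ∨ edgeDegree F i = 2)
    (hsF : ∀ f ∈ F, ∑ i ∈ f, edgeDegree F i = k + 1 ∨ ∑ i ∈ f, edgeDegree F i = k + 2)
    {e : Finset ι} (he : e ∈ E) (hse : k + 2 < ∑ i ∈ e, edgeDegree E i) :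
    trace (k + 2) (edgeTensor k F α) < trace (k + 2) (edgeTensor k E α) := by
  have hsum (p : ℕ) : ∑ i, (edgeDegree E i : ℝ) ^ p = ∑ i, (edgeDegree F i : ℝ) ^ p := by
    rw [sum_edgeDegree_eq_of_mem hE hdeg fun d => (d : ℝ) ^ p,
      sum_edgeDegree_eq_of_mem hF hdeg' fun d => (d : ℝ) ^ p, hcard, hEF]
  rw [trace_edgeTensor_add_two hk hcut hE, trace_edgeTensor_add_two hk hcut' hF, hcard, hsum, hsum]
  have hk1 : (0 : ℝ) < (k : ℝ) - 1 := by
    have : (3 : ℝ) ≤ k := by exact_mod_cast hk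
    linarith
  have hα2 : 0 < 1 - α := by linarith
  have hW : 0 < loopWeight (Fintype.card κ) k 1 1 :=
    loopWeight_pos (by omega) (by rw [← hcard, ← hE e he]; exact Finset.card_le_univ e) 1 1
  refine mul_lt_mul_of_pos_left (add_lt_add_right (mul_lt_mul_of_pos_left (add_lt_add_right
    (mul_lt_mul_of_pos_left ?_ (by positivity)) _) (by positivity)) _) (by positivity)
  -- No integer lies strictly between k + 1 and k + 2, so all terms are nonnegative; the given edge
  -- e makes the sum positive.
  have h1 : 0 < ∑ e ∈ E, ((∑ i ∈ e, (edgeDegree E i : ℝ)) - (k + 1)) *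
      ((∑ i ∈ e, (edgeDegree E i : ℝ)) - (k + 2)) := by
    refine Finset.sum_pos' (fun f _ => ?_) ⟨e, he, ?_⟩
    · rcases le_or_gt (∑ i ∈ f, edgeDegree E i) (k + 1) with h | h
      · have : (∑ i ∈ f, (edgeDegree E i : ℝ)) ≤ k + 1 := by exact_mod_cast h
        exact mul_nonneg_of_nonpos_of_nonpos (by linarith) (by linarith)
      · have : (k + 2 : ℝ) ≤ ∑ i ∈ f, (edgeDegree E i : ℝ) := by exact_mod_cast h
        exact mul_nonneg (by linarith) (by linarith)
    · have : (k + 2 : ℝ) < ∑ i ∈ e, (edgeDegree E i : ℝ) := by exact_mod_cast hse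
      exact mul_pos (by linarith) (by linarith)
  have h2 : ∑ e ∈ F, ((∑ i ∈ e, (edgeDegree F i : ℝ)) - (k + 1)) *
      ((∑ i ∈ e, (edgeDegree F i : ℝ)) - (k + 2)) = 0 := by
    refine Finset.sum_eq_zero fun f hf => ?_
    rcases hsF f hf with h | h
    · have : (∑ i ∈ f, (edgeDegree F i : ℝ)) = k + 1 := by exact_mod_cast h
      rw [this]; ring
    · have : (∑ i ∈ f, (edgeDegree F i : ℝ)) = k + 2 := by exact_mod_cast h
      rw [this]; ring
  rw [sum_edges_mul_eq, hsum, hEF] at h1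
  rw [sum_edges_mul_eq] at h2
  linarith

end

end HTensor

/-! ### Hypertrees through their incidence graph -/

namespace HTensor

section

variable {ι : Type*} {E : Finset (Finset ι)}

/-- The set family `E` is a connected hypergraph without Berge cycles. -/
structure IsEdgeTree (E : Finset (Finset ι)) : Prop where
  nonempty : Nonempty ι
  connected : ∀ u v, Relation.ReflTransGen (fun u v => ∃ e ∈ E, u ∈ e ∧ v ∈ e) u v
  acyclic : ∀ (l : ℕ) (v : Fin (l + 2) → ι) (e : Fin (l + 2) → Finset ι), Function.Injective v →
    Function.Injective e → ¬ ∀ i, e i ∈ E ∧ v i ∈ e i ∧ v (i + 1) ∈ e i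

/-- The bipartite graph of the incident pairs of vertices and edges. -/
def incidenceGraph (E : Finset (Finset ι)) : SimpleGraph (ι ⊕ E) where
  Adj
    | .inl v, .inr e => v ∈ e.1
    | .inr e, .inl v => v ∈ e.1
    | _, _ => False
  symm := ⟨by rintro (u | e) (v | f) h <;> exact h⟩
  loopless := ⟨by rintro (u | e) h <;> exact h⟩

theorem incidenceGraph_adj_inl_inr {v : ι} {e : E} :
    (incidenceGraph E).Adj (.inl v) (.inr e) ↔ v ∈ e.1 := Iff.rfl

theorem incidenceGraph_adj_inr_inl {v : ι} {e : E} :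
    (incidenceGraph E).Adj (.inr e) (.inl v) ↔ v ∈ e.1 := Iff.rfl

theorem not_incidenceGraph_adj_inl_inl {u v : ι} :
    ¬ (incidenceGraph E).Adj (.inl u) (.inl v) := id

theorem not_incidenceGraph_adj_inr_inr {e f : E} :
    ¬ (incidenceGraph E).Adj (.inr e) (.inr f) := id

theorem incidenceGraph_getVert_isLeft {u : ι} {y : ι ⊕ E} (c : (incidenceGraph E).Walk (.inl u) y)
    {i : ℕ} (hi : i ≤ c.length) : (c.getVert i).isLeft = (i % 2 == 0) := by
  induction i with
  | zero => simp
  | succ i ih =>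
    have h := c.adj_getVert_succ (i := i) (by omega)
    have ih := ih (by omega)
    generalize c.getVert i = x at h ih
    generalize c.getVert (i + 1) = z at h ⊢
    rcases x with v | e <;> rcases z with w | f
    · exact absurd h not_incidenceGraph_adj_inl_inl
    · simp at ih ⊢; omega
    · simp at ih ⊢; omega
    · exact absurd h not_incidenceGraph_adj_inr_inr

/-- A cycle alternates between vertices at even positions and edges at odd ones. Its length is even
and at least 3, hence 2(l + 2), and it reads as a Berge cycle of length l + 2. -/
theorem IsEdgeTree.isAcyclic_of_inl (h : IsEdgeTree E) {u : ι}
    (c : (incidenceGraph E).Walk (.inl u) (.inl u)) : ¬ c.IsCycle := by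
  intro hc
  have h3 := hc.three_le_length
  have heven : c.length % 2 = 0 := by
    have := incidenceGraph_getVert_isLeft c le_rfl
    simpa using this
  obtain ⟨l, hl⟩ : ∃ l, c.length = 2 * (l + 2) := ⟨c.length / 2 - 2, by omega⟩
  have hv (i : Fin (l + 2)) : ∃ v, c.getVert (2 * i.1) = .inl v := by
    have := incidenceGraph_getVert_isLeft c (i := 2 * i.1) (by omega)
    rw [Nat.mul_mod_right] at this
    exact Sum.isLeft_iff.1 this
  have he (i : Fin (l + 2)) : ∃ e, c.getVert (2 * i.1 + 1) = .inr e := by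
    have := incidenceGraph_getVert_isLeft c (i := 2 * i.1 + 1) (by omega)
    rw [Nat.mul_add_mod] at this
    exact Sum.isRight_iff.1 (by simpa using this)
  choose v hv using hv
  choose e he using he
  have hsucc (i : Fin (l + 2)) : c.getVert (2 * i.1 + 2) = .inl (v (i + 1)) := by
    rw [← hv]
    by_cases hi : i = Fin.last (l + 1)
    · subst hi
      have : 2 * (Fin.last (l + 1)).1 + 2 = c.length := by simp; omega
      rw [this, c.getVert_length]
      simp
    · rw [Fin.val_add_one, if_neg hi, mul_add]
  have hinj := hc.getVert_injOn'
  refine h.acyclic l v (fun i => (e i).1) (fun i j hij => ?_) (fun i j hij => ?_) fun i => ?_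
  · have := @hinj (2 * i.1) (by simp only [Set.mem_ofPred_eq]; omega) (2 * j.1)
      (by simp only [Set.mem_ofPred_eq]; omega) (by rw [hv, hv, hij])
    exact Fin.ext (by omega)
  · have := @hinj (2 * i.1 + 1) (by simp only [Set.mem_ofPred_eq]; omega) (2 * j.1 + 1)
      (by simp only [Set.mem_ofPred_eq]; omega) (by rw [he, he, Subtype.ext hij])
    exact Fin.ext (by omega)
  · have h1 := c.adj_getVert_succ (i := 2 * i.1) (by omega)
    have h2 := c.adj_getVert_succ (i := 2 * i.1 + 1) (by omega)
    rw [hv, he] at h1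
    rw [he, hsucc] at h2
    exact ⟨(e i).2, h1, h2⟩

variable [DecidableEq ι]

theorem IsEdgeTree.isAcyclic (h : IsEdgeTree E) : (incidenceGraph E).IsAcyclic := by
  intro x c hc
  rcases x with u | e
  · exact h.isAcyclic_of_inl c hc
  · have h3 := hc.three_le_length
    have h1 := c.adj_getVert_succ (i := 0) (by omega)
    have hmem := c.getVert_mem_support 1
    rw [c.getVert_zero] at h1
    rcases hx : c.getVert (0 + 1) with v | f
    · rw [zero_add] at hx
      rw [hx] at hmem
      exact h.isAcyclic_of_inl _ (hc.rotate hmem)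
    · rw [hx] at h1
      exact not_incidenceGraph_adj_inr_inr h1

theorem IsEdgeTree.isTree (h : IsEdgeTree E) (hne : ∀ e ∈ E, e.Nonempty) :
    (incidenceGraph E).IsTree := by
  have hvv (u v : ι) : (incidenceGraph E).Reachable (.inl u) (.inl v) := by
    induction h.connected u v with
    | refl => exact SimpleGraph.Reachable.refl _
    | tail _ hstep ih =>
      obtain ⟨e, he, hu, hv⟩ := hstep
      exact (ih.trans (incidenceGraph_adj_inl_inr (e := ⟨e, he⟩).2 hu).reachable).trans
        (incidenceGraph_adj_inr_inl (e := ⟨e, he⟩).2 hv).reachable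
  have hev (x : ι ⊕ E) : ∃ v, (incidenceGraph E).Reachable x (.inl v) := by
    rcases x with v | e
    · exact ⟨v, SimpleGraph.Reachable.refl _⟩
    · obtain ⟨v, hv⟩ := hne e.1 e.2
      exact ⟨v, (incidenceGraph_adj_inr_inl.2 hv).reachable⟩
  have := h.nonempty
  refine ⟨(SimpleGraph.connected_iff _).2 ⟨fun x y => ?_, inferInstance⟩, h.isAcyclic⟩
  obtain ⟨u, hu⟩ := hev x
  obtain ⟨v, hv⟩ := hev y
  exact (hu.trans (hvv u v)).trans hv.symm

theorem IsEdgeTree.one_le_edgeDegree (h : IsEdgeTree E) (hE0 : E.Nonempty)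
    (hne : ∀ e ∈ E, e.Nonempty) (v : ι) : 1 ≤ edgeDegree E v := by
  rw [edgeDegree, Nat.one_le_iff_ne_zero, ← Nat.pos_iff_ne_zero, Finset.card_pos]
  obtain ⟨e, he⟩ := hE0
  obtain ⟨u, hu⟩ := hne e he
  rcases (h.connected v u).cases_head with rfl | ⟨w, ⟨f, hf, hv, -⟩, -⟩
  · exact ⟨e, by simp [he, hu]⟩
  · exact ⟨f, by simp [hf, hv]⟩

variable [Fintype ι]

/-- In a forest the incidence of v and e is a bridge. Take for C the vertices still reachable from v
after its removal: another vertex of e in C would reconnect v to e, and every other edge keeps all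
its incidences and so lies on one side. -/
theorem IsEdgeTree.hasCuts (h : IsEdgeTree E) : HasCuts E := by
  classical
  intro e he v hv
  have hb := SimpleGraph.isAcyclic_iff_forall_adj_isBridge.1 h.isAcyclic
    (incidenceGraph_adj_inl_inr (e := ⟨e, he⟩).2 hv)
  rw [SimpleGraph.isBridge_iff] at hb
  set G := (incidenceGraph E).deleteEdges {s(.inl v, .inr ⟨e, he⟩)} with hG
  refine ⟨Finset.univ.filter fun w => G.Reachable (.inl v) (.inl w), ?_, fun f hf hfe => ?_⟩
  · ext w
    simp only [Finset.mem_inter, Finset.mem_filter, Finset.mem_univ, true_and, Finset.mem_singleton]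
    constructor
    · rintro ⟨hr, hw⟩
      by_contra hwv
      refine hb (hr.trans (SimpleGraph.Adj.reachable ?_))
      rw [hG, SimpleGraph.deleteEdges_adj]
      exact ⟨hw, by simp [hwv]⟩
    · rintro rfl
      exact ⟨SimpleGraph.Reachable.refl _, hv⟩
  · have hadj (w) (hw : w ∈ f) : G.Adj (.inl w) (.inr ⟨f, hf⟩) := by
      rw [hG, SimpleGraph.deleteEdges_adj]
      exact ⟨hw, by simp [hfe]⟩
    by_cases hd : Disjoint f (Finset.univ.filter fun w => G.Reachable (.inl v) (.inl w))
    · exact .inr hd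
    · obtain ⟨w, hw, hr⟩ := Finset.not_disjoint_iff.1 hd
      left
      intro x hx
      rw [Finset.mem_filter] at hr ⊢
      exact ⟨Finset.mem_univ _, (hr.2.trans (hadj w hw).reachable).trans (hadj x hx).symm.reachable⟩

variable {k : ℕ}

/-- The incidence graph is a tree with n + m nodes and km edges, so n + m = km + 1. -/
theorem IsEdgeTree.card_eq (h : IsEdgeTree E) (hk : 1 ≤ k) (hE : ∀ e ∈ E, e.card = k) :
    Fintype.card ι = E.card * (k - 1) + 1 := by
  classical
  have htree := h.isTree fun e he => Finset.card_pos.1 (by rw [hE e he]; omega)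
  have h1 := htree.card_edgeFinset
  have h2 := (incidenceGraph E).sum_degrees_eq_twice_card_edges
  have hl (v : ι) : (incidenceGraph E).degree (.inl v) = edgeDegree E v := by
    rw [← SimpleGraph.card_neighborFinset_eq_degree]
    have : (incidenceGraph E).neighborFinset (.inl v) =
        (E.attach.filter fun e => v ∈ e.1).map ⟨Sum.inr, Sum.inr_injective⟩ := by
      ext x
      rw [SimpleGraph.mem_neighborFinset]
      rcases x with w | e
      · simp [not_incidenceGraph_adj_inl_inl]
      · simp [incidenceGraph_adj_inl_inr]
    rw [this, Finset.card_map, edgeDegree, Finset.filter_attach (v ∈ ·) E, Finset.card_map,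
      Finset.card_attach]
  have hr (e : E) : (incidenceGraph E).degree (.inr e) = k := by
    rw [← SimpleGraph.card_neighborFinset_eq_degree, ← hE e.1 e.2]
    have : (incidenceGraph E).neighborFinset (.inr e) =
        e.1.map ⟨Sum.inl, Sum.inl_injective⟩ := by
      ext x
      rw [SimpleGraph.mem_neighborFinset]
      rcases x with w | f
      · simp [incidenceGraph_adj_inr_inl]
      · simp [not_incidenceGraph_adj_inr_inr]
    rw [this, Finset.card_map]
  rw [Fintype.sum_sum_type, Finset.sum_congr rfl fun v _ => hl v, Finset.sum_congr rfl fun e _ => hr e,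
    sum_edgeDegree hE, Finset.sum_const, Finset.card_univ, Fintype.card_coe, smul_eq_mul] at h2
  rw [Fintype.card_sum, Fintype.card_coe] at h1
  have h3 : k * E.card = E.card * (k - 1) + E.card := by
    rw [mul_comm, ← Nat.mul_succ, Nat.succ_eq_add_one, Nat.sub_add_cancel hk]
  have h4 : E.card * k = k * E.card := mul_comm _ _
  omega

end

end HTensor

/-! ### Unbranched hypertrees are hyperpaths -/

namespace HTensor

section

variable {ι : Type*} [DecidableEq ι] {E : Finset (Finset ι)} {k : ℕ}

theorem card_le_edgeDegree {v : ι} {A : Finset (Finset ι)} (hA : A ⊆ E) (hv : ∀ e ∈ A, v ∈ e) :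
    A.card ≤ edgeDegree E v :=
  Finset.card_le_card fun e he => Finset.mem_filter.2 ⟨hA he, hv e he⟩

theorem two_le_edgeDegree {v : ι} {e f : Finset ι} (he : e ∈ E) (hf : f ∈ E) (hef : e ≠ f)
    (hve : v ∈ e) (hvf : v ∈ f) : 2 ≤ edgeDegree E v := by
  rw [← Finset.card_pair hef]
  exact card_le_edgeDegree (by simp [Finset.insert_subset_iff, he, hf]) (by simp [hve, hvf])

theorem three_le_edgeDegree {v : ι} {e f g : Finset ι} (he : e ∈ E) (hf : f ∈ E) (hg : g ∈ E)
    (hef : e ≠ f) (heg : e ≠ g) (hfg : f ≠ g) (hve : v ∈ e) (hvf : v ∈ f) (hvg : v ∈ g) :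
    3 ≤ edgeDegree E v := by
  have : ({e, f, g} : Finset (Finset ι)).card = 3 := by
    rw [Finset.card_insert_of_notMem (by simp [hef, heg]), Finset.card_pair hfg]
  rw [← this]
  exact card_le_edgeDegree (by simp [Finset.insert_subset_iff, he, hf, hg]) (by simp [hve, hvf, hvg])

theorem card_add_card_le_sum_edgeDegree (h1 : ∀ v, 1 ≤ edgeDegree E v) {e A : Finset ι} (hA : A ⊆ e)
    (h2 : ∀ v ∈ A, 2 ≤ edgeDegree E v) : e.card + A.card ≤ ∑ v ∈ e, edgeDegree E v := by
  calc e.card + A.card = ∑ v ∈ e, (1 + if v ∈ A then 1 else 0) := by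
        rw [Finset.sum_add_distrib, ← Finset.sum_filter, Finset.filter_mem_eq_inter,
          Finset.inter_eq_right.2 hA, ← Finset.card_eq_sum_ones, ← Finset.card_eq_sum_ones]
    _ ≤ ∑ v ∈ e, edgeDegree E v := by
        refine Finset.sum_le_sum fun v _ => ?_
        split_ifs with hv
        · exact h2 v hv
        · exact h1 v

/-- An injective sequence of `r + 1` edges in which consecutive edges meet. -/
structure IsEdgeChain (E : Finset (Finset ι)) (r : ℕ) (e : ℕ → Finset ι) : Prop where
  mem : ∀ i ≤ r, e i ∈ E
  inj : ∀ i ≤ r, ∀ j ≤ r, e i = e j → i = j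
  meet : ∀ i < r, (e i ∩ e (i + 1)).Nonempty

/-- If no vertex lies in three edges, and no edge meets three others, a chain of edges that starts
at an edge which meets one other edge only can be extended to all edges. -/
theorem IsEdgeTree.exists_chain (h : IsEdgeTree E) (hk : 1 ≤ k) (hE : ∀ e ∈ E, e.card = k)
    (hdeg : ∀ v, edgeDegree E v ≤ 2) (hs : ∀ e ∈ E, ∑ v ∈ e, edgeDegree E v ≤ k + 2)
    {e₀ : Finset ι} (he₀ : e₀ ∈ E) (hs₀ : ∑ v ∈ e₀, edgeDegree E v ≤ k + 1) {r : ℕ}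
    (hr : r < E.card) : ∃ e : ℕ → Finset ι, e 0 = e₀ ∧ IsEdgeChain E r e := by
  have hne : ∀ e ∈ E, e.Nonempty := fun e he => Finset.card_pos.1 (by rw [hE e he]; omega)
  have h1 := h.one_le_edgeDegree ⟨_, he₀⟩ hne
  induction r with
  | zero =>
    refine ⟨fun _ => e₀, rfl, fun _ _ => he₀, fun i hi j hj _ => by omega, fun i hi => by omega⟩
  | succ r ih =>
    obtain ⟨e, h0, he⟩ := ih (by omega)
    -- If no unused edge met the chain, connectedness would place every vertex on the chain,
    -- contradicting that some edge is unused.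
    obtain ⟨f, hf, hfe, j, hj, u, huf, huj⟩ : ∃ f ∈ E, (∀ j ≤ r, f ≠ e j) ∧ ∃ j ≤ r, ∃ u, u ∈ f ∧
        u ∈ e j := by
      by_contra! hcon
      have hall (x : ι) : ∃ j ≤ r, x ∈ e j := by
        obtain ⟨u, hu⟩ := hne _ he₀
        induction h.connected u x with
        | refl => exact ⟨0, Nat.zero_le _, h0 ▸ hu⟩
        | tail _ hstep ih =>
          obtain ⟨g, hg, hy, hz⟩ := hstep
          obtain ⟨j, hj, hyj⟩ := ih
          by_cases hge : ∀ j ≤ r, g ≠ e j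
          · exact absurd hyj (hcon g hg hge j hj _ hy)
          · push Not at hge
            obtain ⟨i, hi, rfl⟩ := hge
            exact ⟨i, hi, hz⟩
      have hlt : ((Finset.range (r + 1)).image e).card < E.card :=
        Finset.card_image_le.trans_lt (by simpa using hr)
      obtain ⟨f, hf, hfe⟩ := Finset.exists_mem_notMem_of_card_lt_card hlt
      obtain ⟨x, hx⟩ := hne f hf
      obtain ⟨j, hj, hxj⟩ := hall x
      refine hcon f hf (fun j hj hfj => hfe ?_) j hj x hx hxj
      exact Finset.mem_image.2 ⟨j, Finset.mem_range.2 (by omega), hfj.symm⟩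
    -- Attached at an earlier e j, the new edge would give e j one shared vertex too many. The
    -- vertices shared with f and with its neighbours in the chain are distinct, as no vertex lies
    -- in three edges, so the degree sum is at least k + 3, or k + 2 for the initial edge.
    have hjr : j = r := by
      by_contra hjr
      have hlt : j < r := by omega
      obtain ⟨w, hw⟩ := he.meet j hlt
      rw [Finset.mem_inter] at hw
      have hjj : e j ≠ e (j + 1) := fun hh => by
        have := he.inj j hj (j + 1) hlt hh
        omega
      have hw2 := two_le_edgeDegree (he.mem j hj) (he.mem _ hlt) hjj hw.1 hw.2
      have hu2 := two_le_edgeDegree hf (he.mem j hj) (hfe j hj) huf huj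
      have huw : u ≠ w := by
        rintro rfl
        have := three_le_edgeDegree hf (he.mem j hj) (he.mem _ hlt) (hfe j hj) (hfe _ hlt) hjj huf huj
          hw.2
        have := hdeg u
        omega
      rcases Nat.eq_zero_or_pos j with rfl | hj0
      · have := card_add_card_le_sum_edgeDegree h1 (e := e 0) (A := {u, w})
          (by simp [Finset.insert_subset_iff, huj, hw.1]) (by simp [hu2, hw2])
        rw [Finset.card_pair huw, hE _ (he.mem 0 hj), h0] at this
        omega
      · obtain ⟨i, rfl⟩ := Nat.exists_eq_succ_of_ne_zero hj0.ne'
        obtain ⟨z, hz⟩ := he.meet i (by omega)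
        rw [Finset.mem_inter] at hz
        have hii : e i ≠ e (i + 1) := fun hh => by
          have := he.inj i (by omega) (i + 1) hj hh
          omega
        have hij : e i ≠ e (i + 1 + 1) := fun hh => by
          have := he.inj i (by omega) (i + 1 + 1) hlt hh
          omega
        have hz2 := two_le_edgeDegree (he.mem i (by omega)) (he.mem _ hj) hii hz.1 hz.2
        have huz : u ≠ z := by
          rintro rfl
          have := three_le_edgeDegree hf (he.mem i (by omega)) (he.mem _ hj) (hfe i (by omega))
            (hfe _ hj) hii huf hz.1 hz.2
          have := hdeg u
          omega
        have hwz : w ≠ z := by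
          rintro rfl
          have := three_le_edgeDegree (he.mem i (by omega)) (he.mem _ hj) (he.mem _ hlt) hii hij hjj
            hz.1 hz.2 hw.2
          have := hdeg w
          omega
        have := card_add_card_le_sum_edgeDegree h1 (e := e (i + 1)) (A := {u, w, z})
          (by simp [Finset.insert_subset_iff, huj, hw.1, hz.2]) (by simp [hu2, hw2, hz2])
        rw [Finset.card_insert_of_notMem (by simp [huw, huz]), Finset.card_pair hwz,
          hE _ (he.mem _ hj)] at this
        have := hs (e (i + 1)) (he.mem _ hj)
        omega
    subst hjr
    refine ⟨Function.update e (j + 1) f, by simp [h0], fun i hi => ?_, fun i hi i' hi' hii' => ?_,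
      fun i hi => ?_⟩
    · by_cases hij : i = j + 1
      · subst hij; simpa using hf
      · rw [Function.update_of_ne hij]; exact he.mem i (by omega)
    · by_cases hij : i = j + 1 <;> by_cases hij' : i' = j + 1
      · omega
      · subst hij
        rw [Function.update_self, Function.update_of_ne hij'] at hii'
        exact absurd hii' (hfe i' (by omega))
      · subst hij'
        rw [Function.update_self, Function.update_of_ne hij] at hii'
        exact absurd hii'.symm (hfe i (by omega))
      · rw [Function.update_of_ne hij, Function.update_of_ne hij'] at hii'
        exact he.inj i (by omega) i' (by omega) hii'
    · rw [Function.update_of_ne (by omega : i ≠ j + 1)]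
      by_cases hij : i = j
      · subst hij
        rw [Function.update_self]
        exact ⟨u, Finset.mem_inter.2 ⟨huj, huf⟩⟩
      · rw [Function.update_of_ne (by omega : i + 1 ≠ j + 1)]
        exact he.meet i (by omega)

theorem IsEdgeChain.mono {r s : ℕ} {e : ℕ → Finset ι} (he : IsEdgeChain E r e) (hs : s ≤ r) :
    IsEdgeChain E s e :=
  ⟨fun i hi => he.mem i (by omega), fun i hi j hj => he.inj i (by omega) j (by omega),
    fun i hi => he.meet i (by omega)⟩

/-- The prescribed last joint w must avoid the earlier edges, so that it differs from the joint
before it. The induction preserves this because that joint already lies in two edges and so in no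
earlier one. -/
theorem IsEdgeChain.exists_joints_of_notMem (hk : 2 ≤ k) (hE : ∀ e ∈ E, e.card = k)
    (hdeg : ∀ v, edgeDegree E v ≤ 2) {r : ℕ} {e : ℕ → Finset ι} (he : IsEdgeChain E r e) {w : ι}
    (hw : w ∈ e r) (hwi : ∀ i < r, w ∉ e i) :
    ∃ p : ℕ → ι, p (r + 1) = w ∧ ∀ i ≤ r, p i ∈ e i ∧ p (i + 1) ∈ e i ∧ p i ≠ p (i + 1) := by
  induction r generalizing w with
  | zero =>
    obtain ⟨a, ha, haw⟩ := Finset.exists_mem_ne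
      (by rw [hE _ (he.mem 0 le_rfl)]; omega : 1 < (e 0).card) w
    refine ⟨fun i => if i = 0 then a else w, by simp, fun i hi => ?_⟩
    obtain rfl : i = 0 := by omega
    simpa using ⟨ha, hw, haw⟩
  | succ r ih =>
    obtain ⟨z, hz⟩ := he.meet r (by omega)
    rw [Finset.mem_inter] at hz
    obtain ⟨p, hpz, hp⟩ := ih (he.mono (by omega)) hz.1 fun i hi hzi => by
      have := three_le_edgeDegree (he.mem i (by omega)) (he.mem r (by omega)) (he.mem (r + 1) le_rfl)
        (fun h => by have := he.inj i (by omega) r (by omega) h; omega)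
        (fun h => by have := he.inj i (by omega) (r + 1) le_rfl h; omega)
        (fun h => by have := he.inj r (by omega) (r + 1) le_rfl h; omega) hzi hz.1 hz.2
      have := hdeg z
      omega
    refine ⟨Function.update p (r + 1 + 1) w, by simp, fun i hi => ?_⟩
    rw [Function.update_of_ne (by omega : i ≠ r + 1 + 1)]
    by_cases hir : i = r + 1
    · subst hir
      rw [Function.update_self, hpz]
      exact ⟨hz.2, hw, fun h => hwi r (by omega) (h ▸ hz.1)⟩
    · rw [Function.update_of_ne (by omega : i + 1 ≠ r + 1 + 1)]
      exact hp i (by omega)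

/-- The vertices in which the consecutive edges of a chain meet, with end vertices added. -/
theorem IsEdgeChain.exists_joints (hk : 2 ≤ k) (hE : ∀ e ∈ E, e.card = k)
    (hdeg : ∀ v, edgeDegree E v ≤ 2) {r : ℕ} {e : ℕ → Finset ι} (he : IsEdgeChain E r e) :
    ∃ p : ℕ → ι, ∀ i ≤ r, p i ∈ e i ∧ p (i + 1) ∈ e i ∧ p i ≠ p (i + 1) := by
  rcases r with _ | r
  · obtain ⟨w, hw⟩ : (e 0).Nonempty := Finset.card_pos.1 (by rw [hE _ (he.mem 0 le_rfl)]; omega)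
    obtain ⟨p, -, hp⟩ := he.exists_joints_of_notMem hk hE hdeg hw fun i hi => by omega
    exact ⟨p, hp⟩
  · obtain ⟨z, hz⟩ := he.meet r (by omega)
    rw [Finset.mem_inter] at hz
    obtain ⟨p, hpz, hp⟩ := (he.mono (Nat.le_succ r)).exists_joints_of_notMem hk hE hdeg hz.1
      fun i hi hzi => by
        have := three_le_edgeDegree (he.mem i (by omega)) (he.mem r (by omega))
          (he.mem (r + 1) le_rfl) (fun h => by have := he.inj i (by omega) r (by omega) h; omega)
          (fun h => by have := he.inj i (by omega) (r + 1) le_rfl h; omega)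
          (fun h => by have := he.inj r (by omega) (r + 1) le_rfl h; omega) hzi hz.1 hz.2
        have := hdeg z
        omega
    obtain ⟨w, hw, hwz⟩ := Finset.exists_mem_ne
      (by rw [hE _ (he.mem (r + 1) le_rfl)]; omega : 1 < (e (r + 1)).card) z
    refine ⟨Function.update p (r + 1 + 1) w, fun i hi => ?_⟩
    rw [Function.update_of_ne (by omega : i ≠ r + 1 + 1)]
    by_cases hir : i = r + 1
    · subst hir
      rw [Function.update_self, hpz]
      exact ⟨hz.2, hw, hwz.symm⟩
    · rw [Function.update_of_ne (by omega : i + 1 ≠ r + 1 + 1)]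
      exact hp i (by omega)

/-- A map on the vertices of a hyperpath with prescribed images of the blocks. -/
theorem exists_block_map {n m : ℕ} (hn : 1 ≤ n) (hE : ∀ e ∈ E, e.card = n + 1)
    {e : ℕ → Finset ι} (he : ∀ i < m + 1, e i ∈ E) {p : ℕ → ι}
    (hp : ∀ i < m + 1, p i ∈ e i ∧ p (i + 1) ∈ e i ∧ p i ≠ p (i + 1)) :
    ∃ σ : ℕ → ι, ∀ i < m + 1, σ '' Set.Icc (i * n) ((i + 1) * n) = e i := by
  have hg (i : ℕ) : ∃ g : ℕ → ι, i < m + 1 → g 0 = p i ∧ g n = p (i + 1) ∧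
      g '' Set.Iic n = e i := by
    by_cases hi : i < m + 1
    · obtain ⟨h1, h2, h3⟩ := hp i hi
      obtain ⟨τ, -, hτ0, hτn⟩ := exists_equiv_finset (ι := Fin (n + 1)) (κ := {v // v ∈ e i})
        (by rw [Fintype.card_fin, Fintype.card_coe, hE _ (he i hi)]) (e := Finset.univ)
        (f := Finset.univ) (by simp [hE _ (he i hi)]) (i := 0) (j := Fin.last n) (i' := ⟨p i, h1⟩)
        (j' := ⟨p (i + 1), h2⟩) (by simp) (by simp) (fun h => by
          have := congrArg Fin.val h
          simp at this
          omega) (by simp) (by simp) (by simpa using h3)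
      refine ⟨fun x => if hx : x < n + 1 then τ ⟨x, hx⟩ else p i, fun _ => ⟨?_, ?_, ?_⟩⟩
      · exact (dif_pos (by omega)).trans (congrArg Subtype.val hτ0)
      · exact (dif_pos (by omega)).trans (congrArg Subtype.val hτn)
      · ext v
        simp only [Set.mem_image, Set.mem_Iic]
        constructor
        · rintro ⟨x, hx, rfl⟩
          rw [dif_pos (by omega)]
          exact (τ _).2
        · intro hv
          refine ⟨(τ.symm ⟨v, hv⟩).1, by omega, ?_⟩
          rw [dif_pos (τ.symm ⟨v, hv⟩).2]
          simp
    · exact ⟨fun _ => p 0, fun h => absurd h hi⟩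
  choose g hg using hg
  -- A joint i * n belongs to two blocks and is read as position 0 of the later one; the maps agree
  -- there. The final vertex (m + 1) * n has no later block, so the default value is the last joint.
  let σ : ℕ → ι := fun x => if x < (m + 1) * n then g (x / n) (x % n) else p (m + 1)
  have hσ (i r : ℕ) (hi : i < m + 1) (hr : r ≤ n) : σ (i * n + r) = g i r := by
    rcases hr.lt_or_eq with hr | rfl
    · have h1 : i * n + n ≤ (m + 1) * n := by
        rw [← Nat.succ_mul]; exact Nat.mul_le_mul_right _ hi
      have h2 : (i * n + r) / n = i := by
        rw [mul_comm, Nat.mul_add_div (by omega), Nat.div_eq_of_lt hr, add_zero]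
      have h3 : (i * n + r) % n = r := by
        rw [mul_comm, Nat.mul_add_mod, Nat.mod_eq_of_lt hr]
      simp only [σ]
      rw [if_pos (by omega), h2, h3]
    · rw [(hg i hi).2.1, ← Nat.succ_mul]
      simp only [σ]
      by_cases him : i = m
      · subst him
        rw [if_neg (by simp)]
      · rw [if_pos (Nat.mul_lt_mul_of_pos_right (by omega) (by omega)),
          Nat.mul_div_cancel _ (by omega), Nat.mul_mod_left]
        exact (hg _ (by omega)).1
  refine ⟨σ, fun i hi => ?_⟩
  rw [← (hg i hi).2.2]
  ext v
  simp only [Set.mem_image, Set.mem_Icc, Set.mem_Iic]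
  constructor
  · rintro ⟨x, ⟨hx1, hx2⟩, rfl⟩
    rw [Nat.succ_mul] at hx2
    refine ⟨x - i * n, by omega, ?_⟩
    rw [← hσ i _ hi (by omega), Nat.add_sub_cancel' hx1]
  · rintro ⟨r, hr, rfl⟩
    exact ⟨i * n + r, ⟨by omega, by rw [Nat.succ_mul]; omega⟩, hσ i r hi hr⟩

variable [Fintype ι]

/-- For degrees 1 and 2 one has d² = 3d - 2, hence ∑ s_e = ∑ d_v² = 3km - 2n = m(k + 2) - 2. The s_e
cannot all be at least k + 2. -/
theorem IsEdgeTree.exists_leaf (h : IsEdgeTree E) (hk : 1 ≤ k) (hE : ∀ e ∈ E, e.card = k)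
    (hE0 : E.Nonempty) (hdeg : ∀ v, edgeDegree E v ≤ 2) :
    ∃ e ∈ E, ∑ v ∈ e, edgeDegree E v ≤ k + 1 := by
  have h1 := h.one_le_edgeDegree hE0 fun e he => Finset.card_pos.1 (by rw [hE e he]; omega)
  have hcard := h.card_eq hk hE
  have hsum := sum_edgeDegree hE
  by_contra! hcon
  have h2 : E.card • (k + 2) ≤ ∑ e ∈ E, ∑ v ∈ e, edgeDegree E v :=
    Finset.card_nsmul_le_sum _ _ _ fun e he => hcon e he
  rw [sum_edges_sum] at h2
  have h3 : ∑ v, edgeDegree E v * edgeDegree E v + 2 * Fintype.card ι ≤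
      3 * ∑ v, edgeDegree E v := by
    rw [Finset.mul_sum, mul_comm 2, ← smul_eq_mul, ← Finset.card_univ, ← Finset.sum_const,
      ← Finset.sum_add_distrib]
    refine Finset.sum_le_sum fun v _ => ?_
    have := h1 v
    have := hdeg v
    interval_cases edgeDegree E v <;> simp
  obtain ⟨n, rfl⟩ : ∃ n, k = n + 1 := ⟨k - 1, by omega⟩
  simp only [Nat.cast_id, smul_eq_mul, Nat.add_sub_cancel] at *
  rw [hsum, hcard] at h3
  nlinarith

/-- The vertices of a uniform hypertree in which no vertex lies in three edges and no edge meets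
three others can be numbered like those of a hyperpath. -/
theorem IsEdgeTree.exists_path_numbering (h : IsEdgeTree E) (hk : 2 ≤ k) (hE : ∀ e ∈ E, e.card = k)
    (hE0 : E.Nonempty) (hdeg : ∀ v, edgeDegree E v ≤ 2)
    (hs : ∀ e ∈ E, ∑ v ∈ e, edgeDegree E v ≤ k + 2) :
    ∃ (σ : ℕ → ι) (e : ℕ → Finset ι), Set.BijOn σ (Set.Iic (E.card * (k - 1))) Set.univ ∧
      (∀ f, f ∈ E ↔ ∃ i < E.card, f = e i) ∧
      ∀ i < E.card, σ '' Set.Icc (i * (k - 1)) ((i + 1) * (k - 1)) = e i := by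
  have hne : ∀ e ∈ E, e.Nonempty := fun e he => Finset.card_pos.1 (by rw [hE e he]; omega)
  obtain ⟨e₀, he₀, hs₀⟩ := h.exists_leaf (by omega) hE hE0 hdeg
  obtain ⟨m, hm⟩ := Nat.exists_eq_succ_of_ne_zero hE0.card_ne_zero
  obtain ⟨e, -, he⟩ := h.exists_chain (r := m) (by omega) hE hdeg hs he₀ hs₀ (by omega)
  obtain ⟨p, hp⟩ := he.exists_joints hk hE hdeg
  obtain ⟨σ, hσ⟩ := exists_block_map (n := k - 1) (m := m) (by omega)
    (fun e he => by rw [hE e he]; omega) (fun i hi => he.mem i (by omega))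
    (fun i hi => hp i (by omega))
  have himg : (Finset.range (m + 1)).image e = E := by
    refine Finset.eq_of_subset_of_card_le (fun f hf => ?_) ?_
    · obtain ⟨i, hi, rfl⟩ := Finset.mem_image.1 hf
      exact he.mem i (by simpa [Nat.lt_succ_iff] using hi)
    · rw [Finset.card_image_of_injOn, Finset.card_range, hm]
      intro i hi j hj hij
      simp only [Finset.coe_range, Set.mem_Iio] at hi hj
      exact he.inj i (by omega) j (by omega) hij
  have hmem (f) : f ∈ E ↔ ∃ i < E.card, f = e i := by
    rw [hm, ← himg, Finset.mem_image]
    simp [eq_comm]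
  have hsurj : Set.SurjOn σ (Set.Iic (E.card * (k - 1))) Set.univ := by
    intro v _
    have h1 := h.one_le_edgeDegree hE0 hne v
    obtain ⟨f, hf⟩ := Finset.card_pos.1 (Nat.pos_of_ne_zero (Nat.one_le_iff_ne_zero.1 h1))
    obtain ⟨hf, hv⟩ := Finset.mem_filter.1 hf
    obtain ⟨i, hi, rfl⟩ := (hmem f).1 hf
    have hv' : v ∈ (e i : Set ι) := hv
    rw [← hσ i (by omega)] at hv'
    obtain ⟨x, hx, rfl⟩ := hv'
    exact ⟨x, hx.2.trans (Nat.mul_le_mul_right _ hi), rfl⟩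
  refine ⟨σ, e, ⟨fun _ _ => Set.mem_univ _, ?_, hsurj⟩, hmem, fun i hi => hσ i (by omega)⟩
  -- Injectivity comes from counting: both sides have m(k-1) + 1 elements.
  have hsurj' : Set.SurjOn σ (Finset.Iic (E.card * (k - 1)) : Finset ℕ)
      ((Finset.univ : Finset ι) : Set ι) := by simpa using hsurj
  have := Finset.injOn_of_surjOn_of_card_le σ (fun _ _ => Finset.mem_univ _) hsurj' (by
    rw [Nat.card_Iic, Finset.card_univ, h.card_eq (by omega) hE])
  simpa using this

end

end HTensor

/-! ### From hypergraphs to finite set families -/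

namespace Hypergraph

open HTensor

section

theorem image_val_injective {V : Type*} {H : Hypergraph V} :
    Function.Injective fun e : Finset H.vertexSet => Subtype.val '' (e : Set H.vertexSet) :=
  fun _ _ h => Finset.coe_injective (Set.image_injective.2 Subtype.val_injective h)

variable {V W : Type*} (H : Hypergraph V) [Fintype H.vertexSet] (G : Hypergraph W)
  [Fintype G.vertexSet]

/-- The hyperedges as finite sets of vertices. -/
noncomputable def edges : Finset (Finset H.vertexSet) :=
  open Classical in
  Finset.univ.filter fun e => Subtype.val '' (e : Set H.vertexSet) ∈ H.edgeSet

variable {H G}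

theorem mem_edges {e : Finset H.vertexSet} :
    e ∈ H.edges ↔ Subtype.val '' (e : Set H.vertexSet) ∈ H.edgeSet := by
  simp [edges]

theorem exists_mem_edges {s : Set V} (hs : s ∈ H.edgeSet) :
    ∃ e ∈ H.edges, Subtype.val '' (e : Set H.vertexSet) = s := by
  classical
  have hsub := H.subset_vertexSet_of_mem_edgeSet' hs
  have h : Subtype.val '' ((Finset.univ.filter fun v : H.vertexSet => v.1 ∈ s :
      Finset H.vertexSet) : Set H.vertexSet) = s := by
    ext v
    simp only [Finset.coe_filter, Finset.mem_univ, true_and, Set.mem_image]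
    constructor
    · rintro ⟨x, hx, rfl⟩; exact hx
    · intro hv; exact ⟨⟨v, hsub hv⟩, hv, rfl⟩
  exact ⟨_, mem_edges.2 (by rw [h]; exact hs), h⟩

theorem card_edges : H.edges.card = H.edgeSet.ncard := by
  rw [← Set.ncard_coe_finset, ← Set.ncard_image_of_injective _ (image_val_injective (H := H))]
  congr 1
  ext s
  constructor
  · rintro ⟨e, he, rfl⟩; exact mem_edges.1 he
  · intro hs
    obtain ⟨e, he, rfl⟩ := exists_mem_edges hs
    exact ⟨e, he, rfl⟩

theorem edgeDegree_edges [DecidableEq H.vertexSet] (v : H.vertexSet) :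
    edgeDegree H.edges v = H.degree v := by
  rw [edgeDegree, degree, ← Set.ncard_coe_finset,
    ← Set.ncard_image_of_injective _ (image_val_injective (H := H))]
  congr 1
  ext s
  constructor
  · rintro ⟨e, he, rfl⟩
    obtain ⟨he, hv⟩ := Finset.mem_filter.1 he
    exact ⟨mem_edges.1 he, ⟨v, hv, rfl⟩⟩
  · rintro ⟨hs, hv⟩
    obtain ⟨e, he, rfl⟩ := exists_mem_edges hs
    obtain ⟨w, hw, hwv⟩ := hv
    rw [Subtype.ext hwv] at hw
    exact ⟨e, by simpa using ⟨he, hw⟩, rfl⟩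

theorem IsUniform.card_eq {k : ℕ} (h : H.IsUniform k) {e : Finset H.vertexSet} (he : e ∈ H.edges) :
    e.card = k := by
  rw [← h _ (mem_edges.1 he), Set.ncard_image_of_injective _ Subtype.val_injective,
    Set.ncard_coe_finset]

theorem alphaTensor_eq_edgeTensor [DecidableEq H.vertexSet] (k : ℕ) (α : ℝ) :
    H.alphaTensor k α = edgeTensor k H.edges α := by
  funext i x
  have h : Subtype.val '' ((insert i (Finset.univ.image x) : Finset H.vertexSet) :
      Set H.vertexSet) = insert (i : V) (Set.range fun j => (x j : V)) := by
    ext v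
    simp [eq_comm]
  simp only [alphaTensor, edgeTensor, Pi.add_apply, Pi.smul_apply, smul_eq_mul]
  unfold degTensor adjTensor
  congr 2
  · rw [edgeDegree_edges]
    congr!
  · by_cases hx : insert i (Finset.univ.image x) ∈ H.edges
    · rw [if_pos hx, if_pos (h ▸ mem_edges.1 hx)]
    · rw [if_neg hx, if_neg fun h' => hx (mem_edges.2 (h.symm ▸ h'))]

theorem alphaTrace_eq_trace [DecidableEq H.vertexSet] (k : ℕ) (α : ℝ) (d : ℕ) :
    H.alphaTrace k α d = trace d (edgeTensor k H.edges α) := by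
  rw [alphaTrace, alphaTensor_eq_edgeTensor]

theorem IsHypertree.isEdgeTree (h : H.IsHypertree) : IsEdgeTree H.edges := by
  obtain ⟨⟨⟨x, hx⟩, hconn⟩, hcyc⟩ := h
  have hadj {u v : V} (huv : H.Adj u v) (hu : u ∈ H.vertexSet) (hv : v ∈ H.vertexSet) :
      ∃ e ∈ H.edges, (⟨u, hu⟩ : H.vertexSet) ∈ e ∧ (⟨v, hv⟩ : H.vertexSet) ∈ e := by
    obtain ⟨s, hs, hus, hvs⟩ := huv
    obtain ⟨e, he, rfl⟩ := exists_mem_edges hs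
    refine ⟨e, he, ?_, ?_⟩
    · simpa [hu] using hus
    · simpa [hv] using hvs
  refine ⟨⟨x, hx⟩, ?_, ?_⟩
  · rintro ⟨u, hu⟩ ⟨v, hv⟩
    have hr := hconn u hu v hv
    induction hr with
    | refl => exact Relation.ReflTransGen.refl
    | tail hr hstep ih =>
      obtain ⟨s, hs, hbs, hcs⟩ := id hstep
      exact (ih (mem_vertexSet_of_mem_edgeSet hs hbs)).tail (hadj hstep _ _)
  · intro l v e hv he hcycle
    refine hcyc l (fun i => v i) (fun i => Subtype.val '' (e i : Set H.vertexSet))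
      ⟨Subtype.val_injective.comp hv, image_val_injective.comp he, fun i => ?_⟩
    obtain ⟨h1, h2, h3⟩ := hcycle i
    exact ⟨mem_edges.1 h1, ⟨_, h2, rfl⟩, ⟨_, h3, rfl⟩⟩

theorem alphaTrace_eq_of_isIsomorphic (h : H.IsIsomorphic G) (k : ℕ) (α : ℝ) (d : ℕ) :
    H.alphaTrace k α d = G.alphaTrace k α d := by
  classical
  obtain ⟨σ, hσ⟩ := h
  have hmem (e : Finset H.vertexSet) : e.map σ.toEmbedding ∈ G.edges ↔ e ∈ H.edges := by
    rw [mem_edges, mem_edges, hσ]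
    simp
  have hdeg (v : H.vertexSet) : edgeDegree H.edges v = edgeDegree G.edges (σ v) := by
    refine Finset.card_bij (fun e _ => e.map σ.toEmbedding) (fun e he => ?_)
      (fun e _ f _ hef => Finset.map_injective _ hef) fun f hf => ?_
    · obtain ⟨he, hv⟩ := Finset.mem_filter.1 he
      exact Finset.mem_filter.2 ⟨(hmem e).2 he, by simpa using hv⟩
    · obtain ⟨hf, hv⟩ := Finset.mem_filter.1 hf
      have hff : (f.map σ.symm.toEmbedding).map σ.toEmbedding = f := by
        ext x; simp
      refine ⟨f.map σ.symm.toEmbedding, Finset.mem_filter.2 ⟨(hmem _).1 (by rwa [hff]), ?_⟩, hff⟩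
      simpa using hv
  rw [alphaTrace_eq_trace, alphaTrace_eq_trace]
  refine trace_reindex σ d _ _ fun i x => ?_
  simp only [edgeTensor, hdeg, Function.comp_apply, σ.injective.eq_iff]
  congr 2
  refine if_congr ?_ rfl rfl
  rw [← hmem, Finset.map_insert, Finset.map_eq_image, Finset.image_image]
  rfl

theorem alphaEq_of_isIsomorphic (h : H.IsIsomorphic G) (k : ℕ) (α : ℝ) : AlphaEq k α H G :=
  ⟨Fintype.card_congr h.choose, fun t _ => alphaTrace_eq_of_isIsomorphic h k α t⟩

end

/-! ### The hyperpath is a uniform hypertree -/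

section Hyperpath

variable {k m : ℕ}

theorem ncard_Icc_block (hk : 1 ≤ k) (i : ℕ) :
    (Set.Icc (i * (k - 1)) ((i + 1) * (k - 1))).ncard = k := by
  rw [← Finset.coe_Icc, Set.ncard_coe_finset, Nat.card_Icc, Nat.succ_mul]
  omega

theorem isUniform_hyperpath (hk : 1 ≤ k) : (hyperpath k m).IsUniform k := by
  rintro e ⟨i, -, rfl⟩
  exact ncard_Icc_block hk i

theorem block_injective (hk : 2 ≤ k) {i j : ℕ}
    (h : Set.Icc (i * (k - 1)) ((i + 1) * (k - 1)) = Set.Icc (j * (k - 1)) ((j + 1) * (k - 1))) :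
    i = j := by
  have h1 : i * (k - 1) ≤ (i + 1) * (k - 1) := Nat.mul_le_mul_right _ (Nat.le_succ i)
  have h2 := ((Set.Icc_subset_Icc_iff h1).1 h.le).1
  have h3 := ((Set.Icc_subset_Icc_iff (Nat.mul_le_mul_right _ (Nat.le_succ j))).1 h.ge).1
  exact Nat.eq_of_mul_eq_mul_right (by omega) (le_antisymm h3 h2)

theorem ncard_edgeSet_hyperpath (hk : 2 ≤ k) : (hyperpath k m).edgeSet.ncard = m := by
  have : (hyperpath k m).edgeSet =
      (fun i => Set.Icc (i * (k - 1)) ((i + 1) * (k - 1))) '' (Finset.range m : Set ℕ) := by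
    ext e
    simp [hyperpath, eq_comm]
  rw [this, Set.ncard_image_of_injective _ fun i j h => block_injective hk h, Set.ncard_coe_finset,
    Finset.card_range]

/-- A vertex of a block that also lies in an earlier block is the first one of the block. -/
theorem eq_of_mem_block_of_lt {i j x : ℕ} (hij : i < j)
    (hi : x ∈ Set.Icc (i * (k - 1)) ((i + 1) * (k - 1)))
    (hj : x ∈ Set.Icc (j * (k - 1)) ((j + 1) * (k - 1))) : x = j * (k - 1) :=
  le_antisymm (hi.2.trans (Nat.mul_le_mul_right _ hij)) hj.1

/-- Consecutive integers share a block, whence connectedness. In a cycle, the block of largest index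
meets the blocks before and after it in the cycle only in its first vertex, so two successive
vertices of the cycle would coincide. -/
theorem isHypertree_hyperpath (hk : 2 ≤ k) : (hyperpath k m).IsHypertree := by
  refine ⟨⟨⟨0, Nat.zero_le _⟩, ?_⟩, ?_⟩
  · have hzero (x : ℕ) (hx : x ∈ (hyperpath k m).vertexSet) :
        Relation.ReflTransGen (hyperpath k m).Adj 0 x := by
      replace hx : x ≤ m * (k - 1) := hx
      induction x with
      | zero => exact Relation.ReflTransGen.refl
      | succ x ih =>
        have hd : 0 < k - 1 := by omega
        have h1 := Nat.div_add_mod' x (k - 1)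
        have h2 := Nat.mod_lt x hd
        have h3 : (x / (k - 1) + 1) * (k - 1) = _ := Nat.succ_mul _ _
        refine Relation.ReflTransGen.tail (ih (by omega)) ⟨_, ⟨x / (k - 1), ?_, rfl⟩, ?_, ?_⟩
        · exact (Nat.div_lt_iff_lt_mul hd).2 (by omega)
        · exact ⟨by omega, by omega⟩
        · exact ⟨by omega, by omega⟩
    intro u hu v hv
    have hsymm : Std.Symm (hyperpath k m).Adj := ⟨fun _ _ h => h.symm⟩
    exact (Std.Symm.symm _ _ (hzero u hu)).trans (hzero v hv)
  · rintro l v e ⟨hv, he, h⟩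
    choose s hs hes using fun i => (h i).1
    obtain ⟨i, hi⟩ := Finite.exists_max s
    have hlt (j) (hj : j ≠ i) : s j < s i := by
      refine lt_of_le_of_ne (hi j) fun hsij => hj (he ?_)
      rw [hes, hes, hsij]
    have hne : ∀ j : Fin (l + 2), j + 1 ≠ j := fun j hj => by
      simp at hj
    have h1 := (h i).2.1
    have h2 := (h i).2.2
    have h3 := (h (i + 1)).2.1
    have h4 := (h (i - 1)).2.2
    rw [sub_add_cancel] at h4
    rw [hes] at h1 h2 h3 h4
    have h5 : i - 1 ≠ i := fun hh => hne (i - 1) (by rw [sub_add_cancel]; exact hh.symm)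
    refine hne i (hv ?_)
    rw [eq_of_mem_block_of_lt (hlt _ (hne i)) h3 h2, eq_of_mem_block_of_lt (hlt _ h5) h4 h1]

end Hyperpath

end Hypergraph

/-! ### Degrees and degree sums in the hyperpath -/

namespace Hypergraph

open HTensor

section

variable {k m : ℕ}

theorem exists_of_mem_edges_hyperpath {f : Finset (hyperpath k m).vertexSet}
    (hf : f ∈ (hyperpath k m).edges) :
    ∃ i < m, ∀ x, x ∈ f ↔ x.1 ∈ Set.Icc (i * (k - 1)) ((i + 1) * (k - 1)) := by
  obtain ⟨i, hi, h⟩ := mem_edges.1 hf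
  refine ⟨i, hi, fun x => ?_⟩
  rw [← h]
  simp

theorem exists_mem_edges_hyperpath {i : ℕ} (hi : i < m) :
    ∃ f ∈ (hyperpath k m).edges, ∀ x : (hyperpath k m).vertexSet,
      x ∈ f ↔ x.1 ∈ Set.Icc (i * (k - 1)) ((i + 1) * (k - 1)) := by
  obtain ⟨f, hf, h⟩ := exists_mem_edges (H := hyperpath k m) ⟨i, hi, rfl⟩
  refine ⟨f, hf, fun x => ?_⟩
  rw [← h]
  simp

theorem degree_hyperpath_le_two (hk : 2 ≤ k) (v : ℕ) : (hyperpath k m).degree v ≤ 2 := by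
  have hd : 0 < k - 1 := by omega
  have hsub : {e ∈ (hyperpath k m).edgeSet | v ∈ e} ⊆
      (((({v / (k - 1), v / (k - 1) - 1} : Finset ℕ).image fun i =>
        Set.Icc (i * (k - 1)) ((i + 1) * (k - 1))) : Finset (Set ℕ)) : Set (Set ℕ)) := by
    rintro e ⟨⟨i, -, rfl⟩, h1, h2⟩
    have h3 : i ≤ v / (k - 1) := (Nat.le_div_iff_mul_le hd).2 h1
    have h4 : v / (k - 1) ≤ i + 1 := Nat.div_le_of_le_mul (by rwa [mul_comm])
    rw [Finset.coe_image]
    exact ⟨i, by simp; omega, rfl⟩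
  refine (Set.ncard_le_ncard hsub (Finset.finite_toSet _)).trans ?_
  rw [Set.ncard_coe_finset]
  exact Finset.card_image_le.trans Finset.card_le_two

theorem degree_hyperpath_le_one {v i : ℕ} (h1 : i * (k - 1) < v) (h2 : v < (i + 1) * (k - 1)) :
    (hyperpath k m).degree v ≤ 1 := by
  have hsub : {e ∈ (hyperpath k m).edgeSet | v ∈ e} ⊆
      {Set.Icc (i * (k - 1)) ((i + 1) * (k - 1))} := by
    rintro e ⟨⟨j, -, rfl⟩, hj⟩
    rcases lt_trichotomy i j with hij | rfl | hij
    · have := eq_of_mem_block_of_lt hij ⟨h1.le, h2.le⟩ hj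
      have := Nat.mul_le_mul_right (k - 1) (show i + 1 ≤ j from hij)
      omega
    · rfl
    · have := eq_of_mem_block_of_lt hij hj ⟨h1.le, h2.le⟩
      omega
  exact (Set.ncard_le_ncard hsub (Set.finite_singleton _)).trans (Set.ncard_singleton _).le

theorem sum_edgeDegree_hyperpath_le (hk : 2 ≤ k) {f : Finset (hyperpath k m).vertexSet}
    (hf : f ∈ (hyperpath k m).edges) :
    ∑ v ∈ f, edgeDegree (hyperpath k m).edges v ≤ k + 2 := by
  obtain ⟨i, -, h⟩ := exists_of_mem_edges_hyperpath hf
  have hone (a : ℕ) : ∑ v ∈ f, (if v.1 = a then 1 else 0) ≤ 1 := by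
    rw [← Finset.sum_filter, ← Finset.card_eq_sum_ones, Finset.card_le_one]
    intro x hx y hy
    exact Subtype.ext ((Finset.mem_filter.1 hx).2.trans (Finset.mem_filter.1 hy).2.symm)
  calc ∑ v ∈ f, edgeDegree (hyperpath k m).edges v
      ≤ ∑ v ∈ f, (1 + (if v.1 = i * (k - 1) then 1 else 0) +
          if v.1 = (i + 1) * (k - 1) then 1 else 0) := by
        refine Finset.sum_le_sum fun v hv => ?_
        rw [edgeDegree_edges]
        obtain ⟨hv1, hv2⟩ := (h v).1 hv
        have := degree_hyperpath_le_two (m := m) hk v.1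
        by_cases h1 : v.1 = i * (k - 1)
        · rw [if_pos h1]; omega
        · by_cases h2 : v.1 = (i + 1) * (k - 1)
          · rw [if_pos h2]; omega
          · have := degree_hyperpath_le_one (m := m) (lt_of_le_of_ne hv1 (Ne.symm h1))
              (lt_of_le_of_ne hv2 h2)
            omega
    _ ≤ k + 2 := by
        rw [Finset.sum_add_distrib, Finset.sum_add_distrib, ← Finset.card_eq_sum_ones,
          (isUniform_hyperpath (by omega)).card_eq hf]
        have := hone (i * (k - 1))
        have := hone ((i + 1) * (k - 1))
        omega

theorem le_sum_edgeDegree_hyperpath (hk : 2 ≤ k) (hm : 2 ≤ m)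
    {f : Finset (hyperpath k m).vertexSet} (hf : f ∈ (hyperpath k m).edges)
    (h1 : ∀ v, 1 ≤ edgeDegree (hyperpath k m).edges v) :
    k + 1 ≤ ∑ v ∈ f, edgeDegree (hyperpath k m).edges v := by
  obtain ⟨i, hi, h⟩ := exists_of_mem_edges_hyperpath hf
  have hjoint (j : ℕ) (hj : j + 1 < m) (hij : i = j ∨ i = j + 1) :
      ∃ v ∈ f, 2 ≤ edgeDegree (hyperpath k m).edges v := by
    have hd : k - 1 ≠ 0 := by omega
    obtain ⟨g, hg, hgm⟩ := exists_mem_edges_hyperpath (k := k) (show j < m by omega)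
    obtain ⟨g', hg', hgm'⟩ := exists_mem_edges_hyperpath (k := k) hj
    have h3 : j * (k - 1) ≤ (j + 1) * (k - 1) := Nat.mul_le_mul_right _ (Nat.le_succ j)
    have h4 : (j + 1) * (k - 1) ≤ (j + 1 + 1) * (k - 1) := Nat.mul_le_mul_right _ (Nat.le_succ _)
    let v : (hyperpath k m).vertexSet :=
      ⟨(j + 1) * (k - 1), Nat.mul_le_mul_right (k - 1) (show j + 1 ≤ m by omega)⟩
    have hvg : v ∈ g := (hgm v).2 ⟨h3, le_rfl⟩
    have hvg' : v ∈ g' := (hgm' v).2 ⟨le_rfl, h4⟩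
    have hne : g ≠ g' := by
      rintro rfl
      let u : (hyperpath k m).vertexSet :=
        ⟨j * (k - 1), Nat.mul_le_mul_right (k - 1) (show j ≤ m by omega)⟩
      have hu : (j + 1) * (k - 1) ≤ j * (k - 1) := ((hgm' u).1 ((hgm u).2 ⟨le_rfl, h3⟩)).1
      rw [Nat.succ_mul] at hu
      omega
    refine ⟨v, ?_, two_le_edgeDegree hg hg' hne hvg hvg'⟩
    rw [h]
    rcases hij with rfl | rfl
    · exact ⟨h3, le_rfl⟩
    · exact ⟨le_rfl, h4⟩
  obtain ⟨v, hv, hv2⟩ : ∃ v ∈ f, 2 ≤ edgeDegree (hyperpath k m).edges v := by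
    by_cases him : i + 1 < m
    · exact hjoint i him (.inl rfl)
    · exact hjoint (i - 1) (by omega) (.inr (by omega))
  have := card_add_card_le_sum_edgeDegree h1 (e := f) (A := {v}) (by simpa using hv)
    (by simpa using hv2)
  rwa [(isUniform_hyperpath (by omega)).card_eq hf, Finset.card_singleton] at this

end

/-! ### Recognition of the hyperpath and the final comparison -/

section

variable {V : Type*} {T : Hypergraph V} [Fintype T.vertexSet] {k m : ℕ}

/-- A uniform hypertree in which no vertex lies in three edges and no edge meets three others is a
hyperpath. -/
theorem isIsomorphic_hyperpath [DecidableEq T.vertexSet] (hk : 2 ≤ k) (hT : T.IsUniform k)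
    (htree : T.IsHypertree) (hm : T.edges.card = m) (hdeg : ∀ v, edgeDegree T.edges v ≤ 2)
    (hs : ∀ e ∈ T.edges, ∑ v ∈ e, edgeDegree T.edges v ≤ k + 2) :
    (hyperpath k m).IsIsomorphic T := by
  -- Without edges, both sides are a single vertex.
  rcases Nat.eq_zero_or_pos m with rfl | hm0
  · have h1 := (isHypertree_hyperpath (m := 0) hk).isEdgeTree.card_eq (by omega)
      fun e he => (isUniform_hyperpath (by omega)).card_eq he
    have h2 := htree.isEdgeTree.card_eq (by omega) fun e he => hT.card_eq he
    rw [card_edges, ncard_edgeSet_hyperpath hk] at h1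
    refine ⟨Fintype.equivOfCardEq (by rw [h1, h2, hm]), fun s => ?_⟩
    refine iff_of_false (fun ⟨i, hi, _⟩ => absurd hi (Nat.not_lt_zero i)) fun h => ?_
    obtain ⟨e, he, -⟩ := exists_mem_edges h
    exact absurd hm (Finset.card_ne_zero_of_mem he)
  · obtain ⟨σ, e, hσ, he, himg⟩ := htree.isEdgeTree.exists_path_numbering hk
      (fun e he => hT.card_eq he) (Finset.card_pos.1 (hm ▸ hm0)) hdeg hs
    rw [hm] at hσ he himg
    let τ : (hyperpath k m).vertexSet ≃ T.vertexSet :=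
      Equiv.ofBijective (fun x => σ x.1) ⟨fun x y hxy => Subtype.ext (hσ.injOn x.2 y.2 hxy),
        fun v => by
          obtain ⟨x, hx, hxv⟩ := hσ.surjOn (Set.mem_univ v)
          exact ⟨⟨x, hx⟩, hxv⟩⟩
    have hτ (s : Set (hyperpath k m).vertexSet) : τ '' s = σ '' (Subtype.val '' s) := by
      rw [Set.image_image]
      rfl
    refine ⟨τ, fun s => ⟨?_, fun h => ?_⟩⟩
    · rintro ⟨i, hi, hsi⟩
      rw [hτ, hsi, himg i hi]
      exact mem_edges.1 ((he _).2 ⟨i, hi, rfl⟩)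
    · obtain ⟨f, hf, hfs⟩ := exists_mem_edges h
      obtain ⟨i, hi, rfl⟩ := (he f).1 hf
      refine ⟨i, hi, ?_⟩
      have hfs' := Set.image_injective.2 Subtype.val_injective hfs
      rw [hτ, ← himg i hi] at hfs'
      exact ((hσ.injOn.image_eq_image_iff (fun x hx => hx.2.trans (Nat.mul_le_mul_right _ hi))
        (by rintro _ ⟨x, -, rfl⟩; exact x.2)).1 hfs').symm

/-- A uniform hypertree that is not a hyperpath comes after the hyperpath in `S_α`-order. -/
theorem alphaLT_hyperpath (hk : 3 ≤ k) {α : ℝ} (hα0 : 0 < α) (hα1 : α < 1) (hT : T.IsUniform k)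
    (htree : T.IsHypertree) (hm : T.edgeSet.ncard = m)
    (hiso : ¬ (hyperpath k m).IsIsomorphic T) : AlphaLT k α (hyperpath k m) T := by
  classical
  have hk1 : 1 ≤ k := by omega
  have hk2 : 2 ≤ k := by omega
  rw [← card_edges] at hm
  have hP := (isHypertree_hyperpath (m := m) hk2).isEdgeTree
  have hT' := htree.isEdgeTree
  have hPE : ∀ e ∈ (hyperpath k m).edges, e.card = k := fun e he =>
    (isUniform_hyperpath hk1).card_eq he
  have hTE : ∀ e ∈ T.edges, e.card = k := fun e he => hT.card_eq he
  have hPm : (hyperpath k m).edges.card = m := by rw [card_edges, ncard_edgeSet_hyperpath hk2]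
  have hcardP := hP.card_eq hk1 hPE
  have hcardT := hT'.card_eq hk1 hTE
  rw [hPm] at hcardP
  rw [hm] at hcardT
  have hcard : Fintype.card T.vertexSet = Fintype.card (hyperpath k m).vertexSet := by
    rw [hcardP, hcardT]
  -- The deciding order must lie in the range of the definition. For m ≥ 2 there are n ≥ 2k - 1
  -- vertices and the power is at least k - 1 ≥ 2, so the bound is at least 2n - 1 ≥ k + 2.
  have hle (h2 : 2 ≤ m) : k + 2 ≤ Fintype.card (hyperpath k m).vertexSet *
      (k - 1) ^ (Fintype.card (hyperpath k m).vertexSet - 1) - 1 := by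
    have h3 : 2 * (k - 1) ≤ m * (k - 1) := Nat.mul_le_mul_right _ h2
    have h4 : 2 ≤ (k - 1) ^ (Fintype.card (hyperpath k m).vertexSet - 1) := by
      calc 2 ≤ k - 1 := by omega
        _ = (k - 1) ^ 1 := (pow_one _).symm
        _ ≤ _ := Nat.pow_le_pow_right (by omega) (by omega)
    have h5 := Nat.mul_le_mul_left (Fintype.card (hyperpath k m).vertexSet) h4
    omega
  have hm0 : m ≠ 0 := by
    rintro rfl
    refine hiso (isIsomorphic_hyperpath hk2 hT htree hm (fun v => ?_) fun e he => ?_)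
    · rw [edgeDegree, Finset.card_eq_zero.1 hm]; simp
    · exact absurd hm (Finset.card_ne_zero_of_mem he)
  have hP1 := hP.one_le_edgeDegree (Finset.card_pos.1 (by omega)) fun e he =>
    Finset.card_pos.1 (by rw [hPE e he]; omega)
  have hT1 := hT'.one_le_edgeDegree (Finset.card_pos.1 (by omega)) fun e he =>
    Finset.card_pos.1 (by rw [hTE e he]; omega)
  have hP2 (v) : edgeDegree (hyperpath k m).edges v = 1 ∨ edgeDegree (hyperpath k m).edges v = 2 := by
    have h1 := hP1 v
    have h2 := degree_hyperpath_le_two (m := m) hk2 v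
    rw [← edgeDegree_edges] at h2
    omega
  refine ⟨hcard.symm, ?_⟩
  simp only [alphaTrace_eq_trace]
  by_cases hdeg : ∀ v, edgeDegree T.edges v ≤ 2
  · have hT2 (v) : edgeDegree T.edges v = 1 ∨ edgeDegree T.edges v = 2 := by
      have h1 := hT1 v
      have h2 := hdeg v
      omega
    obtain ⟨e, he, hse⟩ : ∃ e ∈ T.edges, k + 2 < ∑ v ∈ e, edgeDegree T.edges v := by
      by_contra! hcon
      exact hiso (isIsomorphic_hyperpath hk2 hT htree hm hdeg hcon)
    -- With at most one edge, all degrees are at most 1 and no degree sum exceeds k.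
    have hm2 : 2 ≤ m := by
      by_contra hlt
      have h1 : ∑ v ∈ e, edgeDegree T.edges v ≤ e.card • 1 := Finset.sum_le_card_nsmul _ _ _
        fun v _ => (Finset.card_filter_le _ _).trans (by omega)
      rw [hTE e he, smul_eq_mul, mul_one] at h1
      omega
    refine ⟨k + 2, by omega, hle hm2, fun t ht => ?_, ?_⟩
    · exact trace_edgeTensor_eq_of_degree hk hcard (hm.trans hPm.symm) hT'.hasCuts hTE hP.hasCuts hPE
        α hT2 hP2 ht
    · refine trace_edgeTensor_add_two_lt hk hcard (hm.trans hPm.symm) hT'.hasCuts hTE hP.hasCuts hPE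
        hα0 hα1 hT2 hP2 (fun f hf => ?_) he hse
      have h1 := sum_edgeDegree_hyperpath_le hk2 hf
      have h2 := le_sum_edgeDegree_hyperpath hk2 hm2 hf hP1
      omega
  · push Not at hdeg
    obtain ⟨v, hv⟩ := hdeg
    have hm2 : 2 ≤ m := by
      have : edgeDegree T.edges v ≤ T.edges.card := Finset.card_filter_le _ _
      omega
    have := hle hm2
    refine ⟨2, by omega, by omega, fun t ht => ?_, ?_⟩
    · interval_cases t
      · rw [trace_zero, trace_zero, hcard]
      · exact (trace_edgeTensor_one_eq hk2 hcard (hm.trans hPm.symm) hT'.hasCuts hTE hP.hasCuts hPE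
          α).symm
    · exact trace_edgeTensor_two_lt hk hcard (hm.trans hPm.symm) hT'.hasCuts hTE hP.hasCuts hPE hα0
        hT1 hP2 hv

end

end Hypergraph

theorem mainTheorem4 (k m : ℕ) (hk : 3 ≤ k) (α : ℝ) (hα0 : 0 < α) (hα1 : α < 1) :
    ((Hypergraph.hyperpath k m).IsUniform k ∧
      (Hypergraph.hyperpath k m).IsHypertree ∧
      (Hypergraph.hyperpath k m).edgeSet.ncard = m) ∧
    ∀ (V : Type*) (T : Hypergraph V) [Fintype T.vertexSet],
      T.IsUniform k → T.IsHypertree → T.edgeSet.ncard = m →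
        Hypergraph.AlphaLE k α (Hypergraph.hyperpath k m) T ∧
        (¬ (Hypergraph.hyperpath k m).IsIsomorphic T →
          Hypergraph.AlphaLT k α (Hypergraph.hyperpath k m) T) := by
  refine ⟨⟨Hypergraph.isUniform_hyperpath (by omega), Hypergraph.isHypertree_hyperpath (by omega),
    Hypergraph.ncard_edgeSet_hyperpath (by omega)⟩, ?_⟩
  intro V T _ hT htree hm
  have hlt := Hypergraph.alphaLT_hyperpath hk hα0 hα1 hT htree hm
  refine ⟨?_, hlt⟩
  by_cases hiso : (Hypergraph.hyperpath k m).IsIsomorphic T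
  · exact .inr (Hypergraph.alphaEq_of_isIsomorphic hiso k α)
  · exact .inl (hlt hiso)
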